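/- **Notation.** $\log$ is the natural logarithm with the convention $\log x=1$ for every $x\le e$. Let $d,n\ge 1$ be integers, and let $\mathbf X=[X_1\cdots X_n]\in\mathbb R^{d\times n}$ have all its columns in the closed Euclidean unit ball $\mathcal B_d$ of $\mathbb R^d$ (written $\mathbf X\in\mathcal B_d^n$). Put $\mathbf\Sigma=\frac1n\mathbf X\mathbf X^T$ and $\mathrm{tr}=\mathrm{tr}(\mathbf\Sigma)=\frac1n\sum_i\|X_i\|_2^2$. For $\beta>0$ let $$\eta(d,\beta)=\sqrt{d+2\sqrt{d\log(1/\beta)}+2\log(1/\beta)},$$ $$\upsilon(d,\beta)=2\sqrt d+2d^{1/6}\log^{1/3}d+\frac{6\bigl(1+(\log d/d)^{1/3}\bigr)\sqrt{\log d}}{\sqrt{\log\bigl(1+(\log d/d)^{1/3}\bigr)}}+2\sqrt{2\log(1/\beta)},$$ and for $t\ge0$, $\rho>0$ let $$\mathrm{Err}_{d,n,\rho,\beta}(t)=\frac{2^{1.25}\sqrt{t}}{\rho^{1/4}\sqrt n}\sqrt{\upsilon(d,\beta/2)}+\frac{\sqrt2}{\sqrt\rho\,n}\,\eta(d,\beta/2).$$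 **Algorithm SeparateCov** (input $\mathbf X\in\mathcal B_d^n$, privacy parameter $\rho>0$). Let $\lambda_1\ge\dots\ge\lambda_d$ be the eigenvalues of $\mathbf\Sigma$. Draw $\mathbf Y\sim\mathcal N(0,\mathbf I_{d\times d})$ and, independently, a symmetric $d\times d$ matrix $\mathbf W$ whose entries on and above the diagonal are i.i.d. $\mathcal N(0,1)$. Set $\widetilde{\mathbf\Lambda}=\mathrm{diag}(\lambda_1,\dots,\lambda_d)+\frac{\sqrt2}{\sqrt\rho\,n}\mathrm{diag}(\mathbf Y)$ and $\widetilde{\mathbf\Sigma}_{\mathrm{Gau}}=\mathbf\Sigma+\frac{1}{\sqrt{\rho/2}\,n}\mathbf W$. Let $\widetilde{\mathbf P}$ be an orthogonal matrix whose $i$-th column is an eigenvector of $\widetilde{\mathbf\Sigma}_{\mathrm{Gau}}$ for its $i$-th largest eigenvalue (with multiplicity; any choice is allowed). Return $\widetilde{\mathbf\Sigma}_{\mathrm{Sep}}=\widetilde{\mathbf P}\widetilde{\mathbf\Lambda}\widetilde{\mathbf P}^T$. **Theorem.** 1. For all $d,n\ge1$, every $\rho>0$, every $\mathbf X\in\mathcal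 B_d^n$ and every $\beta>0$, with probability at least $1-\beta$ (whatever the choice of eigenvectors) the output of SeparateCov satisfies $$\|\widetilde{\mathbf\Sigma}_{\mathrm{Sep}}-\mathbf\Sigma\|_F\le \mathrm{Err}_{d,n,\rho,\beta}(\mathrm{tr})=\frac{2^{1.25}\sqrt{\mathrm{tr}}}{\rho^{1/4}\sqrt n}\sqrt{\upsilon(d,\beta/2)}+\frac{\sqrt2}{\sqrt\rho\,n}\,\eta(d,\beta/2).$$ 2. This bound is $\tilde O\bigl(d^{1/4}\sqrt{\mathrm{tr}}/\sqrt n+\sqrt d/n\bigr)$: there are absolute constants $C>0$ and $k\in\mathbb N$ such that for all $d,n\ge1$, $\rho>0$, $\mathbf X\in\mathcal B_d^n$ and $\beta>0$, $$\mathrm{Err}_{d,n,\rho,\beta}(\mathrm{tr})\le C\,\bigl(\log d\cdot\log(1/\beta)\bigr)^k\left(\frac{d^{1/4}\sqrt{\mathrm{tr}}}{\rho^{1/4}\sqrt n}+\frac{\sqrt d}{\sqrt\rho\,n}\right).$$ 3. Setting $\mathrm{tr}=1$ gives the worst-case bound $\tilde O(d^{1/4}/\sqrt n)$ in the regime $d\le\tilde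 O(n^2)$: for every $K>0$ and $m\in\mathbb N$ there are $C>0$ and $k\in\mathbb N$, depending only on $K$ and $m$, such that for all $d,n\ge1$ with $d\le K(\log n)^m n^2$, all $\rho>0$, $\mathbf X\in\mathcal B_d^n$ and $\beta>0$, $$\mathrm{Err}_{d,n,\rho,\beta}(\mathrm{tr})\le\mathrm{Err}_{d,n,\rho,\beta}(1)\le C\left(\frac1{\rho^{1/4}}+\frac1{\sqrt\rho}\right)\bigl(\log d\cdot\log n\cdot\log(1/\beta)\bigr)^k\,\frac{d^{1/4}}{\sqrt n}.$$ -/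

import Mathlib

open MeasureTheory ProbabilityTheory Matrix

noncomputable section

namespace SepCov

/-- The natural logarithm with the convention that `log x = 1` for every `x ≤ e`. -/
def plog (x : ℝ) : ℝ :=
  if x ≤ Real.exp 1 then 1 else Real.log x

/-- The bound `η(d, β)` for the norm of a standard Gaussian vector. -/
def eta (d : ℕ) (β : ℝ) : ℝ :=
  √((d : ℝ) + 2 * √((d : ℝ) * plog (1 / β)) + 2 * plog (1 / β))

/-- The bound `υ(d, β)` for the operator norm of a symmetric Gaussian Wigner matrix.
Every logarithm, the one in the denominator included, is read with the convention of `plog`; the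
last one is then equal to `1`, and with the plain natural logarithm there the bound would only be
larger. -/
def upsilon (d : ℕ) (β : ℝ) : ℝ :=
  2 * √(d : ℝ)
    + 2 * (d : ℝ) ^ (1 / 6 : ℝ) * (plog d) ^ (1 / 3 : ℝ)
    + 6 * (1 + (plog d / d) ^ (1 / 3 : ℝ)) * √(plog d)
        / √(plog (1 + (plog d / d) ^ (1 / 3 : ℝ)))
    + 2 * √(2 * plog (1 / β))

/-- The error bound, as a function of the dimension `d`, the number `n` of data points, the privacy
parameter `ρ`, the failure probability `β` and the trace `t` of the covariance matrix. -/
def errBound (d n : ℕ) (ρ β t : ℝ) : ℝ :=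
  (2 : ℝ) ^ (5 / 4 : ℝ) * √t / (ρ ^ (1 / 4 : ℝ) * √(n : ℝ)) * √(upsilon d (β / 2))
    + √2 / (√ρ * n) * eta d (β / 2)

/-- All columns of `X` lie in the closed Euclidean unit ball of `ℝ^d`. -/
def ColsInBall {d n : ℕ} (X : Matrix (Fin d) (Fin n) ℝ) : Prop :=
  ∀ i : Fin n, ‖WithLp.toLp 2 (fun j : Fin d => X j i)‖ ≤ 1

/-- The empirical covariance matrix `Σ = (1/n) X Xᵀ`. -/
def empCov {d n : ℕ} (X : Matrix (Fin d) (Fin n) ℝ) : Matrix (Fin d) (Fin d) ℝ :=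
  (1 / (n : ℝ)) • (X * Xᵀ)

section
attribute [local instance] Matrix.frobeniusNormedAddCommGroup

/-- The Frobenius norm. -/
def frobNorm {d : ℕ} (A : Matrix (Fin d) (Fin d) ℝ) : ℝ := ‖A‖

end

/-- The positions on and above the diagonal of a `d × d` matrix. -/
abbrev UpperIdx (d : ℕ) : Type := {p : Fin d × Fin d // p.1 ≤ p.2}

/-- The symmetric matrix with the given entries on and above the diagonal. -/
def symMatrix {d : ℕ} (g : UpperIdx d → ℝ) : Matrix (Fin d) (Fin d) ℝ :=
  Matrix.of fun j k => g ⟨(min j k, max j k), min_le_max⟩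

/-- `GaussCov` with privacy parameter `ρ`, run with the symmetric noise matrix `W = symMatrix g`:
it returns `Σ + (1 / (√ρ n)) W`. -/
def gaussCov {d n : ℕ} (X : Matrix (Fin d) (Fin n) ℝ) (ρ : ℝ) (g : UpperIdx d → ℝ) :
    Matrix (Fin d) (Fin d) ℝ :=
  empCov X + (1 / (√ρ * n)) • symMatrix g

theorem empCov_isHermitian {d n : ℕ} (X : Matrix (Fin d) (Fin n) ℝ) :
    (empCov X).IsHermitian := by
  unfold Matrix.IsHermitian empCov
  simp [Matrix.conjTranspose_eq_transpose_of_trivial, Matrix.transpose_mul]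

theorem gaussCov_isHermitian {d n : ℕ} (X : Matrix (Fin d) (Fin n) ℝ) (ρ : ℝ)
    (g : UpperIdx d → ℝ) : (gaussCov X ρ g).IsHermitian := by
  refine (empCov_isHermitian X).add ?_
  ext j k
  simp [symMatrix, min_comm, max_comm]

/-- The eigenvalues of a symmetric `d × d` matrix with multiplicity, in nonincreasing order. -/
def sortedEigenvalues {d : ℕ} {A : Matrix (Fin d) (Fin d) ℝ} (hA : A.IsHermitian) : Fin d → ℝ :=
  fun i => hA.eigenvalues₀ (Fin.cast (Fintype.card_fin d).symm i)

/-- `P` is a matrix of eigenvectors of the symmetric matrix `A`: it is orthogonal and its `i`-th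
column belongs to the `i`-th largest eigenvalue. -/
def IsEigenvectorMatrix {d : ℕ} {A : Matrix (Fin d) (Fin d) ℝ} (hA : A.IsHermitian)
    (P : Matrix (Fin d) (Fin d) ℝ) : Prop :=
  P ∈ Matrix.orthogonalGroup (Fin d) ℝ ∧
    A = P * Matrix.diagonal (sortedEigenvalues hA) * Pᵀ

/-- `S` is an output of `SeparateCov` on data `X` with privacy parameter `ρ` when the Gaussian
vector `y` is used for the eigenvalues and the Gaussian entries `g` for the eigenvectors.
A matrix of eigenvectors is not unique; every choice of it gives an output. -/
def IsSeparateCovOutput {d n : ℕ} (X : Matrix (Fin d) (Fin n) ℝ) (ρ : ℝ)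
    (y : Fin d → ℝ) (g : UpperIdx d → ℝ) (S : Matrix (Fin d) (Fin d) ℝ) : Prop :=
  ∃ P : Matrix (Fin d) (Fin d) ℝ,
    IsEigenvectorMatrix (gaussCov_isHermitian X (ρ / 2) g) P ∧
      S = P * Matrix.diagonal
            (fun i => sortedEigenvalues (empCov_isHermitian X) i + √2 / (√ρ * n) * y i) * Pᵀ

/-- The law of the noise of `SeparateCov`: `d` entries of the vector `y` and the entries on and
above the diagonal of the symmetric matrix, all independent standard Gaussians. -/
def noiseLaw (d : ℕ) : Measure ((Fin d → ℝ) × (UpperIdx d → ℝ)) :=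
  (Measure.pi fun _ : Fin d => gaussianReal 0 1).prod
    (Measure.pi fun _ : UpperIdx d => gaussianReal 0 1)

/-- Every symmetric matrix has a matrix of eigenvectors. -/
theorem exists_isEigenvectorMatrix {d : ℕ} {A : Matrix (Fin d) (Fin d) ℝ} (hA : A.IsHermitian) :
    ∃ P, IsEigenvectorMatrix hA P := by
  let τ : Fin d ≃ Fin d :=
    (finCongr (Fintype.card_fin d).symm).trans (Fintype.equivOfCardEq (Fintype.card_fin _))
  have hs : sortedEigenvalues hA = hA.eigenvalues ∘ τ := by
    funext i
    simp [sortedEigenvalues, Matrix.IsHermitian.eigenvalues, τ, finCongr]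
  let U : Matrix (Fin d) (Fin d) ℝ := hA.eigenvectorUnitary
  have hU : U * Uᵀ = 1 := by
    have := (Matrix.mem_unitaryGroup_iff (A := U)).1 hA.eigenvectorUnitary.2
    simpa [Matrix.star_eq_conjTranspose, Matrix.conjTranspose_eq_transpose_of_trivial] using this
  refine ⟨U.submatrix id τ, ?_, ?_⟩
  · rw [Matrix.mem_orthogonalGroup_iff, Matrix.transpose_submatrix,
      Matrix.submatrix_mul_equiv, hU]
    simp
  · have h := hA.spectral_theorem
    rw [Unitary.conjStarAlgAut_apply] at h
    rw [hs, ← Matrix.submatrix_diagonal_equiv, Matrix.submatrix_mul_equiv,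
      Matrix.transpose_submatrix, Matrix.submatrix_mul_equiv]
    simpa [Matrix.star_eq_conjTranspose, Matrix.conjTranspose_eq_transpose_of_trivial,
      Function.comp_def, U] using h

/-- `SeparateCov` always has an output. -/
theorem exists_isSeparateCovOutput {d n : ℕ} (X : Matrix (Fin d) (Fin n) ℝ) (ρ : ℝ)
    (y : Fin d → ℝ) (g : UpperIdx d → ℝ) : ∃ S, IsSeparateCovOutput X ρ y g S := by
  obtain ⟨P, hP⟩ := exists_isEigenvectorMatrix (gaussCov_isHermitian X (ρ / 2) g)
  exact ⟨_, P, hP, rfl⟩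

end SepCov

end

/-!
The noise of `SeparateCov` enters the error in two separate ways.

The vector noise on the eigenvalues contributes exactly its Euclidean norm, as conjugation by an
orthogonal matrix preserves the Frobenius norm. That norm is at most `η` by the chi-square tail
bound `gaussPi_sq_norm_tail`.

The matrix noise `E` only affects the eigenvectors. If `Σ = Q Λ Qᵀ` and `Σ + E = P M Pᵀ`, then
`T = P Λ Pᵀ` maximises the pairing with `Σ + E` among the matrices with spectrum `Λ` (von Neumann's
trace inequality, `trace_mul_le_sum_mul`), and `T` and `Σ` have the same Frobenius norm, so
`‖T - Σ‖² = 2 tr (Σ²) - 2 tr (T Σ) ≤ 2 tr ((T - Σ) E) ≤ 4 ‖E‖ tr Σ`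
(`frobNorm_conj_diagonal_sub_sq_le`). Here `‖E‖` is the operator norm, which is handled throughout
as a bound for the quadratic form.

It remains to see that a symmetric Gaussian matrix has operator norm at most
`2 √d + 6 √(plog d) + 2 √(2 plog (1 / β)) ≤ υ` with probability `1 - β`. An additional independent
diagonal noise turns it into a matrix of the Gaussian orthogonal ensemble, at the price of a factor
`2` in the probability (`gaussPi_wignerSet_le`). For the latter, rotations are used as in the
reduction to tridiagonal form (`gaussPi_spikedSet_le`): removing the first coordinate replaces a
border `h` by a rank one term of norm `‖h‖` in the remaining block, which a rotation moves to the
corner of that block. So the largest eigenvalue exceeds `t` only if, at one of the steps, the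
corner entry plus the norms of two successive borders exceeds `t`. Such a sum has exponential moment
at most `exp (2 lam √d + 2 lam²)`, and a union bound over the steps gives the tail
`(d + 1) exp (-s² / 8)` at `2 √d + s`. The only fact about Gaussian laws needed besides exponential
moments is that coisometries preserve them (`map_gaussPi`).
-/

noncomputable section

namespace SepCov

/-! ### Standard Gaussian vectors -/

/-- The law of a family of independent standard Gaussian variables indexed by `ι`. -/
def gaussPi (ι : Type*) [Fintype ι] : Measure (ι → ℝ) :=
  Measure.pi fun _ => gaussianReal 0 1

instance (ι : Type*) [Fintype ι] : IsProbabilityMeasure (gaussPi ι) := by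
  unfold gaussPi; infer_instance

/-- A coisometry maps a standard Gaussian vector to a standard Gaussian vector. The map `f` is given
together with its adjoint `f'`, which is isometric. -/
theorem map_gaussPi {J K : Type*} [Fintype J] [Fintype K] (f : (J → ℝ) → (K → ℝ))
    (hf : Measurable f) (f' : (K → ℝ) → (J → ℝ))
    (hadj : ∀ x t, ∑ k, t k * f x k = ∑ j, f' t j * x j)
    (hiso : ∀ t, ∑ j, f' t j ^ 2 = ∑ k, t k ^ 2) :
    (gaussPi J).map f = gaussPi K := by
  classical
  have key : ((gaussPi J).map f).map (WithLp.toLp 2)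
      = (gaussPi K).map (WithLp.toLp 2) := by
    apply Measure.ext_of_charFun (E := EuclideanSpace ℝ K)
    ext t
    have h2 : (gaussPi K).map (WithLp.toLp 2) = stdGaussian (EuclideanSpace ℝ K) :=
      map_pi_eq_stdGaussian
    have h1 : (gaussPi J).map (WithLp.toLp 2) = stdGaussian (EuclideanSpace ℝ J) :=
      map_pi_eq_stdGaussian
    have h3 := charFun_stdGaussian (E := EuclideanSpace ℝ J) (WithLp.toLp 2 (f' t.ofLp))
    rw [← Complex.ofReal_pow, EuclideanSpace.real_norm_sq_eq] at h3
    rw [h2, charFun_stdGaussian, ← Complex.ofReal_pow, EuclideanSpace.real_norm_sq_eq,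
      ← hiso t.ofLp]
    refine Eq.trans ?_ h3
    rw [← h1, charFun_apply, charFun_apply, integral_map (by fun_prop)
      (Measurable.aestronglyMeasurable (by fun_prop)), integral_map (by fun_prop)
      (Measurable.aestronglyMeasurable (by fun_prop)), integral_map (by fun_prop)
      (Measurable.aestronglyMeasurable (by fun_prop))]
    congr 1
    ext x
    have := hadj x t.ofLp
    simp only [PiLp.inner_apply, RCLike.inner_apply, conj_trivial]
    rw [this]
  exact (MeasurableEquiv.toLp 2 (K → ℝ)).map_measurableEquiv_injective key

/-- Selecting coordinates of a standard Gaussian vector gives a standard Gaussian vector. -/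
theorem map_gaussPi_comp {J K : Type*} [Fintype J] [Fintype K] (e : K → J)
    (he : Function.Injective e) : (gaussPi J).map (fun x k => x (e k)) = gaussPi K := by
  classical
  refine map_gaussPi _ (by fun_prop) (fun t j => ∑ k, if e k = j then t k else 0) ?_ ?_
  · intro x t
    simp_rw [Finset.sum_mul]
    rw [Finset.sum_comm]
    simp
  · intro t
    have h : ∀ j, (∑ k, if e k = j then t k else 0) ^ 2 = ∑ k, if e k = j then t k ^ 2 else 0 := by
      intro j
      by_cases hj : ∃ k, e k = j
      · obtain ⟨k, rfl⟩ := hj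
        simp [he.eq_iff]
      · push Not at hj
        simp [hj]
    simp_rw [h]
    rw [Finset.sum_comm]
    simp

/-- The law of a Gaussian vector is symmetric. -/
theorem map_gaussPi_neg {J : Type*} [Fintype J] :
    (gaussPi J).map (fun x => -x) = gaussPi J :=
  map_gaussPi _ (by fun_prop) (fun t => -t) (by simp) (by simp)

/-- The two blocks of a standard Gaussian vector are independent. -/
theorem map_gaussPi_sum {J K : Type*} [Fintype J] [Fintype K] :
    ((gaussPi J).prod (gaussPi K)).map (fun p => Sum.elim p.1 p.2) = gaussPi (J ⊕ K) := by
  have h := measurePreserving_sumPiEquivProdPi_symm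
    (fun _ : J ⊕ K => gaussianReal 0 1)
  have h2 := h.map_eq
  have : (fun p : (J → ℝ) × (K → ℝ) => (Sum.elim p.1 p.2 : J ⊕ K → ℝ))
      = (MeasurableEquiv.sumPiEquivProdPi fun _ : J ⊕ K => ℝ).symm := by
    funext p k
    rcases k with k | k <;> rfl
  rw [this]
  exact h2

theorem lintegral_gaussPi_prod {ι : Type*} [Fintype ι] (f : ι → ℝ → ENNReal)
    (hf : ∀ i, Measurable (f i)) :
    ∫⁻ x, ∏ i, f i (x i) ∂gaussPi ι = ∏ i, ∫⁻ z, f i z ∂gaussianReal 0 1 := by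
  have h := lintegral_prod_eq_prod_lintegral_of_indepFun (μ := gaussPi ι) Finset.univ
    (fun i x => f i (x i)) (iIndepFun_pi fun i => (hf i).aemeasurable) (by fun_prop)
  rw [h]
  refine Finset.prod_congr rfl fun i _ => ?_
  exact (measurePreserving_eval (fun _ : ι => gaussianReal 0 1) i).lintegral_comp (hf i)

theorem lintegral_exp_sq_gaussianReal {v : ℝ} (hv : 1 ≤ v) :
    ∫⁻ z, ENNReal.ofReal (Real.exp ((1 - 1 / v) / 2 * z ^ 2)) ∂gaussianReal 0 1
      = ENNReal.ofReal √v := by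
  have hv0 : 0 < v := by linarith
  have hvn : v.toNNReal ≠ 0 := (Real.toNNReal_pos.2 hv0).ne'
  rw [gaussianReal_of_var_ne_zero _ one_ne_zero,
    lintegral_withDensity_eq_lintegral_mul _ (measurable_gaussianPDF _ _) (by fun_prop)]
  have : ∀ z, (gaussianPDF 0 1 * fun z => ENNReal.ofReal (Real.exp ((1 - 1 / v) / 2 * z ^ 2))) z
      = ENNReal.ofReal √v * gaussianPDF 0 v.toNNReal z := by
    intro z
    rw [Pi.mul_apply]
    simp only [gaussianPDF]
    rw [← ENNReal.ofReal_mul (gaussianPDFReal_nonneg _ _ _),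
      ← ENNReal.ofReal_mul (Real.sqrt_nonneg _)]
    congr 1
    simp only [gaussianPDFReal, NNReal.coe_one, Real.coe_toNNReal v hv0.le, sub_zero, mul_one]
    rw [mul_assoc, ← Real.exp_add, Real.sqrt_mul (by positivity), Real.sqrt_mul (by positivity) v]
    have hs : √v ≠ 0 := (Real.sqrt_pos.2 hv0).ne'
    have : -z ^ 2 / 2 + (1 - 1 / v) / 2 * z ^ 2 = -z ^ 2 / (2 * v) := by field_simp; ring
    rw [this]
    field_simp
    exact Real.sqrt_mul (by positivity) _
  simp_rw [this]
  rw [lintegral_const_mul _ (measurable_gaussianPDF _ _), lintegral_gaussianPDF_eq_one _ hvn, mul_one]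

/-- The exponential moments of a chi-square variable, for the exponent `θ = (1 - 1 / v) / 2`. -/
theorem lintegral_exp_sq_gaussPi {ι : Type*} [Fintype ι] {v : ℝ} (hv : 1 ≤ v) :
    ∫⁻ x, ENNReal.ofReal (Real.exp ((1 - 1 / v) / 2 * ∑ i, x i ^ 2)) ∂gaussPi ι
      = ENNReal.ofReal (√v ^ Fintype.card ι) := by
  simp_rw [Finset.mul_sum, Real.exp_sum,
    ENNReal.ofReal_prod_of_nonneg fun _ _ => (Real.exp_pos _).le]
  rw [lintegral_gaussPi_prod (fun _ z => ENNReal.ofReal (Real.exp ((1 - 1 / v) / 2 * z ^ 2)))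
    (by fun_prop), lintegral_exp_sq_gaussianReal hv, Finset.prod_const,
    ENNReal.ofReal_pow (Real.sqrt_nonneg _), Finset.card_univ]

theorem sqrt_pow_le_exp {v c : ℝ} (hv : 0 < v) (h : Real.log v ≤ c) (n : ℕ) :
    √v ^ n ≤ Real.exp (n * c / 2) := by
  have : √v ≤ Real.exp (c / 2) := by
    rw [Real.sqrt_le_left (Real.exp_pos _).le, ← Real.exp_nat_mul]
    rw [← Real.exp_log hv]
    apply Real.exp_le_exp.2
    push_cast
    linarith
  calc √v ^ n ≤ Real.exp (c / 2) ^ n := by gcongr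
    _ = _ := by rw [← Real.exp_nat_mul]; ring_nf

theorem log_le_sub_inv_div_two {v : ℝ} (hv : 1 ≤ v) : Real.log v ≤ (v - 1 / v) / 2 := by
  have h := Real.self_le_sinh_iff.2 (Real.log_nonneg hv)
  rw [Real.sinh_eq, Real.exp_neg, Real.exp_log (by linarith)] at h
  simpa using h

/-- Markov's inequality for an exponential moment. -/
theorem measure_lt_le_of_lintegral_exp {Ω : Type*} [MeasurableSpace Ω] (μ : Measure Ω)
    {f : Ω → ℝ} (hf : Measurable f) {a b : ℝ}
    (h : ∫⁻ x, ENNReal.ofReal (Real.exp (f x)) ∂μ ≤ ENNReal.ofReal (Real.exp b)) :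
    μ {x | a < f x} ≤ ENNReal.ofReal (Real.exp (b - a)) := by
  have h0 : ENNReal.ofReal (Real.exp a) * μ {x | a < f x} ≤ ENNReal.ofReal (Real.exp b) := by
    refine le_trans ?_ h
    refine le_trans ?_ (mul_meas_ge_le_lintegral₀ (μ := μ) (by fun_prop)
      (ENNReal.ofReal (Real.exp a)))
    exact mul_le_mul_right (measure_mono fun x hx =>
      ENNReal.ofReal_le_ofReal (Real.exp_le_exp.2 (le_of_lt hx))) _
  have hpos : ENNReal.ofReal (Real.exp a) ≠ 0 := by simp [Real.exp_pos]
  rw [mul_comm, ← ENNReal.le_div_iff_mul_le (Or.inl hpos) (Or.inl ENNReal.ofReal_ne_top)] at h0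
  rwa [Real.exp_sub, ENNReal.ofReal_div_of_pos (Real.exp_pos _)]

/-- The Laurent–Massart tail bound for the squared norm of a Gaussian vector. -/
theorem gaussPi_sq_norm_tail {ι : Type*} [Fintype ι] [Nonempty ι] {u : ℝ} (hu : 0 < u) :
    gaussPi ι {x | (Fintype.card ι : ℝ) + 2 * √(Fintype.card ι * u) + 2 * u < ∑ i, x i ^ 2}
      ≤ ENNReal.ofReal (Real.exp (-u)) := by
  set d := Fintype.card ι with hd
  have hd0 : (0 : ℝ) < d := by
    rw [hd]; exact_mod_cast Fintype.card_pos
  set a := √(d : ℝ)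
  set b := √u
  have ha : 0 < a := Real.sqrt_pos.2 hd0
  have hb : 0 < b := Real.sqrt_pos.2 hu
  have ha2 : (d : ℝ) = a ^ 2 := (Real.sq_sqrt hd0.le).symm
  have hb2 : u = b ^ 2 := (Real.sq_sqrt hu.le).symm
  have hab : √(d * u) = a * b := Real.sqrt_mul hd0.le u
  -- The exponent `θ = b / (a + 2 b)` minimises the Chernoff bound in which `log v` is replaced by
  -- its upper bound `(v - 1 / v) / 2`.
  set v := (a + 2 * b) / a with hvdef
  have hv : 1 ≤ v := by rw [hvdef, le_div_iff₀ ha]; linarith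
  have hθ : (1 - 1 / v) / 2 = b / (a + 2 * b) := by
    rw [hvdef]; field_simp; ring
  have hθ0 : 0 < (1 - 1 / v) / 2 := by rw [hθ]; positivity
  have h1 := lintegral_exp_sq_gaussPi (ι := ι) hv
  have h2 := sqrt_pow_le_exp (by linarith) (log_le_sub_inv_div_two hv) d
  have h3 := measure_lt_le_of_lintegral_exp (gaussPi ι)
    (f := fun x => (1 - 1 / v) / 2 * ∑ i, x i ^ 2) (by fun_prop)
    (a := (1 - 1 / v) / 2 * ((d : ℝ) + 2 * √(d * u) + 2 * u))
    (h1.le.trans (ENNReal.ofReal_le_ofReal h2))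
  have h4 : (d : ℝ) * ((v - 1 / v) / 2) / 2
      - (1 - 1 / v) / 2 * ((d : ℝ) + 2 * √(d * u) + 2 * u) = -u := by
    rw [hθ, hab, ha2, hb2, hvdef]
    field_simp
    ring
  rw [h4] at h3
  refine le_trans (measure_mono ?_) h3
  intro x hx
  exact mul_lt_mul_of_pos_left hx hθ0

/-- The exponential moments of the norm of a Gaussian vector in dimension at most `D`. -/
theorem lintegral_exp_norm_gaussPi {ι : Type*} [Fintype ι] {D lam : ℝ} (hD : 0 < D)
    (hιD : (Fintype.card ι : ℝ) ≤ D) (hlam : 0 ≤ lam) :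
    ∫⁻ x, ENNReal.ofReal (Real.exp (lam * √(∑ i, x i ^ 2))) ∂gaussPi ι
      ≤ ENNReal.ofReal (Real.exp (lam * √D + lam ^ 2 / 2)) := by
  have hs : 0 < √D := Real.sqrt_pos.2 hD
  have hs2 : √D ^ 2 = D := Real.sq_sqrt hD.le
  -- With `r = lam + √D`, the norm `N` is at most `(N² / r + r) / 2`.
  set r := lam + √D with hr
  have hr0 : 0 < r := by positivity
  set v := r / √D with hv
  have hv1 : 1 ≤ v := by rw [hv, le_div_iff₀ hs]; linarith
  have hθ : (1 - 1 / v) / 2 = lam / (2 * r) := by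
    rw [hv, hr]; field_simp; ring
  have hpt : ∀ x : ι → ℝ, ENNReal.ofReal (Real.exp (lam * √(∑ i, x i ^ 2)))
      ≤ ENNReal.ofReal (Real.exp (lam * r / 2))
        * ENNReal.ofReal (Real.exp ((1 - 1 / v) / 2 * ∑ i, x i ^ 2)) := by
    intro x
    rw [← ENNReal.ofReal_mul (Real.exp_pos _).le, ← Real.exp_add]
    refine ENNReal.ofReal_le_ofReal (Real.exp_le_exp.2 ?_)
    have hN : √(∑ i, x i ^ 2) ^ 2 = ∑ i, x i ^ 2 := Real.sq_sqrt (by positivity)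
    rw [hθ]
    set N := √(∑ i, x i ^ 2)
    have : lam * r / 2 + lam / (2 * r) * N ^ 2 - lam * N = lam / (2 * r) * (N - r) ^ 2 := by
      field_simp; ring
    rw [hN] at this
    have : 0 ≤ lam / (2 * r) * (N - r) ^ 2 := by positivity
    linarith
  refine (lintegral_mono hpt).trans ?_
  rw [lintegral_const_mul _ (by fun_prop), lintegral_exp_sq_gaussPi hv1,
    ← ENNReal.ofReal_mul (Real.exp_pos _).le]
  refine ENNReal.ofReal_le_ofReal ?_
  have h2 := sqrt_pow_le_exp (by linarith) (Real.log_le_sub_one_of_pos (by linarith : 0 < v))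
    (Fintype.card ι)
  have hv2 : v - 1 = lam / √D := by rw [hv, hr]; field_simp; ring
  calc _ ≤ Real.exp (lam * r / 2) * Real.exp (D * (v - 1) / 2) := by
        gcongr
        refine h2.trans (Real.exp_le_exp.2 ?_)
        have : 0 ≤ v - 1 := by linarith
        gcongr
    _ = _ := by
        rw [← Real.exp_add, hv2, hr]
        congr 1
        nth_rewrite 2 [← hs2]
        field_simp
        ring

/-- The exponential moments of a single standard Gaussian variable. -/
theorem lintegral_exp_gaussPi_unit (c : ℝ) :
    ∫⁻ x, ENNReal.ofReal (Real.exp (c * x ())) ∂gaussPi Unit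
      = ENNReal.ofReal (Real.exp (c ^ 2 / 2)) := by
  have h := lintegral_gaussPi_prod (ι := Unit) (fun _ z => ENNReal.ofReal (Real.exp (c * z)))
    (by fun_prop)
  simp only [Finset.univ_unique, Finset.prod_singleton] at h
  refine h.trans ?_
  rw [← ofReal_integral_eq_lintegral_ofReal (integrable_exp_mul_gaussianReal c)
    (Filter.Eventually.of_forall fun _ => (Real.exp_pos _).le)]
  have := congrFun (mgf_fun_id_gaussianReal (μ := 0) (v := 1)) c
  simp only [mgf] at this
  rw [this]
  simp

/-! ### Spiked Gaussian matrices and rotations -/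

/-- The matrices `A` for which the quadratic form `√2 ⟨y, A y⟩ + ⟨h, y⟩² / ‖h‖` exceeds `t ‖y‖²`
somewhere. The rank one term has operator norm `‖h‖`, and it vanishes for `h = 0`. For a standard
Gaussian `A`, the first term is the form of the Gaussian orthogonal ensemble. -/
def spikedSet {k : ℕ} (t : ℝ) (h : Fin k → ℝ) : Set (Fin k × Fin k → ℝ) :=
  {A | ∃ y : Fin k → ℝ, t * ∑ i, y i ^ 2 <
    √2 * ∑ i, ∑ j, A (i, j) * (y i * y j) + (∑ i, h i * y i) ^ 2 / √(∑ i, h i ^ 2)}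

theorem isOpen_spikedSet {k : ℕ} (t : ℝ) (h : Fin k → ℝ) : IsOpen (spikedSet t h) := by
  simp only [spikedSet, Set.ofPred_exists]
  exact isOpen_iUnion fun y => isOpen_lt (by fun_prop) (by fun_prop)

theorem sum_mul_entries_eq_trace {n : Type*} [Fintype n] (M N : Matrix n n ℝ) :
    ∑ p : n × n, M p.1 p.2 * N p.1 p.2 = (Mᵀ * N).trace := by
  rw [Fintype.sum_prod_type, Finset.sum_comm]
  simp [Matrix.trace, Matrix.mul_apply]

/-- Conjugation by an orthogonal matrix preserves the law of a Gaussian matrix. -/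
theorem map_gaussPi_conj {n : Type*} [Fintype n] [DecidableEq n] {O : Matrix n n ℝ}
    (hO : Oᵀ * O = 1) :
    (gaussPi (n × n)).map (fun A p => (O * Matrix.of (fun i j => A (i, j)) * Oᵀ) p.1 p.2)
      = gaussPi (n × n) := by
  have hO' : O * Oᵀ = 1 := mul_eq_one_comm.1 hO
  refine map_gaussPi _ ?_ (fun T p => (Oᵀ * Matrix.of (fun i j => T (i, j)) * O) p.1 p.2) ?_ ?_
  · refine measurable_pi_lambda _ fun p => ?_
    simp only [Matrix.mul_apply, Matrix.of_apply]
    fun_prop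
  · intro A T
    have h1 := sum_mul_entries_eq_trace (Matrix.of (fun i j => T (i, j)))
      (O * Matrix.of (fun i j => A (i, j)) * Oᵀ)
    have h2 := sum_mul_entries_eq_trace (Oᵀ * Matrix.of (fun i j => T (i, j)) * O)
      (Matrix.of (fun i j => A (i, j)))
    simp only [Matrix.of_apply] at h1 h2
    rw [h1, h2, ← Matrix.mul_assoc, Matrix.trace_mul_comm]
    simp only [Matrix.transpose_mul, Matrix.transpose_transpose, Matrix.mul_assoc]
  · intro T
    have h1 := sum_mul_entries_eq_trace (Matrix.of (fun i j => T (i, j)))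
      (Matrix.of (fun i j => T (i, j)))
    have h2 := sum_mul_entries_eq_trace (Oᵀ * Matrix.of (fun i j => T (i, j)) * O)
      (Oᵀ * Matrix.of (fun i j => T (i, j)) * O)
    simp only [Matrix.of_apply] at h1 h2
    simp only [sq, h1, h2]
    set S := Matrix.of (fun i j => T (i, j))
    calc ((Oᵀ * S * O)ᵀ * (Oᵀ * S * O)).trace = (Oᵀ * (Sᵀ * (O * Oᵀ) * S * O)).trace := by
          simp only [Matrix.transpose_mul, Matrix.transpose_transpose, Matrix.mul_assoc]
      _ = (Sᵀ * S).trace := by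
          rw [Matrix.trace_mul_comm, hO', Matrix.mul_one, Matrix.mul_assoc, hO', Matrix.mul_one]

theorem mulVec_dotProduct_mulVec {n : Type*} [Fintype n] [DecidableEq n]
    {O : Matrix n n ℝ} (hO : Oᵀ * O = 1) (y z : n → ℝ) :
    (O *ᵥ y) ⬝ᵥ (O *ᵥ z) = y ⬝ᵥ z := by
  rw [Matrix.dotProduct_mulVec, ← Matrix.mulVec_transpose, Matrix.mulVec_mulVec, hO,
    Matrix.one_mulVec]

theorem sum_sq_eq_dotProduct {n : Type*} [Fintype n] (y : n → ℝ) : ∑ i, y i ^ 2 = y ⬝ᵥ y := by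
  simp [dotProduct, sq]

theorem sum_sum_eq_dotProduct {n : Type*} [Fintype n] (M : Matrix n n ℝ) (y : n → ℝ) :
    ∑ i, ∑ j, M i j * (y i * y j) = y ⬝ᵥ (M *ᵥ y) := by
  simp only [dotProduct, mulVec, Finset.mul_sum]
  exact Finset.sum_congr rfl fun i _ => Finset.sum_congr rfl fun j _ => by ring

theorem gaussPi_spikedSet_le_rotate {k : ℕ} (t : ℝ) (h : Fin k → ℝ)
    {O : Matrix (Fin k) (Fin k) ℝ} (hO : Oᵀ * O = 1) :
    gaussPi _ (spikedSet t h) ≤ gaussPi _ (spikedSet t (O *ᵥ h)) := by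
  have hm : Measurable fun (A : Fin k × Fin k → ℝ) (p : Fin k × Fin k) =>
      (O * Matrix.of (fun i j => A (i, j)) * Oᵀ) p.1 p.2 := by
    refine measurable_pi_lambda _ fun p => ?_
    simp only [Matrix.mul_apply, Matrix.of_apply]
    fun_prop
  conv_rhs => rw [← map_gaussPi_conj hO, Measure.map_apply hm (isOpen_spikedSet t _).measurableSet]
  refine measure_mono ?_
  rintro A ⟨y, hy⟩
  refine ⟨O *ᵥ y, ?_⟩
  have e1 := sum_sum_eq_dotProduct (Matrix.of (fun i j => A (i, j))) y
  have e2 := sum_sum_eq_dotProduct (O * Matrix.of (fun i j => A (i, j)) * Oᵀ) (O *ᵥ y)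
  simp only [Matrix.of_apply] at e1
  have e3 : ∀ u v : Fin k → ℝ, ∑ i, u i * v i = u ⬝ᵥ v := fun _ _ => rfl
  change _ < √2 * ∑ i, ∑ j, (O * Matrix.of (fun i j => A (i, j)) * Oᵀ) i j
    * ((O *ᵥ y) i * (O *ᵥ y) j) + _
  rw [e1] at hy
  rw [e2]
  simp only [e3, sum_sq_eq_dotProduct] at hy ⊢
  rw [mulVec_dotProduct_mulVec hO, mulVec_dotProduct_mulVec hO,
    mulVec_dotProduct_mulVec hO, Matrix.mulVec_mulVec, Matrix.mul_assoc,
    Matrix.mul_assoc, hO, Matrix.mul_one, ← Matrix.mulVec_mulVec,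
    mulVec_dotProduct_mulVec hO]
  exact hy

/-- A Householder reflection carries `h` to `‖h‖ e₀`. -/
theorem exists_orthogonal_mulVec_eq {k : ℕ} (h : Fin (k + 1) → ℝ) :
    ∃ O : Matrix (Fin (k + 1)) (Fin (k + 1)) ℝ, Oᵀ * O = 1 ∧
      O *ᵥ h = Pi.single 0 √(∑ i, h i ^ 2) := by
  set c := √(∑ i, h i ^ 2) with hc
  have hc2 : c ^ 2 = h ⬝ᵥ h := by
    rw [hc, Real.sq_sqrt (by positivity), sum_sq_eq_dotProduct]
  set e : Fin (k + 1) → ℝ := Pi.single 0 c with he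
  set w := h - e with hw
  have hee : e ⬝ᵥ e = h ⬝ᵥ h := by rw [← hc2, he]; simp [sq]
  by_cases hw0 : w ⬝ᵥ w = 0
  · refine ⟨1, by simp, ?_⟩
    rw [Matrix.one_mulVec]
    exact sub_eq_zero.1 (dotProduct_self_eq_zero.1 hw0)
  · have hsym : (vecMulVec w w)ᵀ = vecMulVec w w := by
      ext i j; simp [vecMulVec_apply, mul_comm]
    refine ⟨1 - (2 / (w ⬝ᵥ w)) • vecMulVec w w, ?_, ?_⟩
    · rw [Matrix.transpose_sub, Matrix.transpose_smul, hsym, Matrix.transpose_one]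
      have : vecMulVec w w * vecMulVec w w = (w ⬝ᵥ w) • vecMulVec w w := by
        rw [Matrix.vecMulVec_mul_vecMulVec]
        ext i j; simp [vecMulVec_apply]; ring
      rw [Matrix.sub_mul, Matrix.one_mul, Matrix.mul_sub, Matrix.mul_one, Matrix.smul_mul,
        Matrix.mul_smul, this, smul_smul, smul_smul]
      have : 2 / (w ⬝ᵥ w) * (2 / (w ⬝ᵥ w)) * (w ⬝ᵥ w) = 2 / (w ⬝ᵥ w) + 2 / (w ⬝ᵥ w) := by
        field_simp; ring
      rw [this, add_smul]
      abel
    · rw [Matrix.sub_mulVec, Matrix.one_mulVec, Matrix.smul_mulVec]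
      have h1 : vecMulVec w w *ᵥ h = (w ⬝ᵥ h) • w := by
        ext i; simp [mulVec, dotProduct, vecMulVec_apply, Finset.sum_mul]
        exact Finset.sum_congr rfl fun j _ => by ring
      have h2 : w ⬝ᵥ w = 2 * (w ⬝ᵥ h) := by
        have : w ⬝ᵥ w = w ⬝ᵥ h - w ⬝ᵥ e := by rw [← dotProduct_sub]
        have h3 : w ⬝ᵥ h = h ⬝ᵥ h - e ⬝ᵥ h := by rw [hw, sub_dotProduct]
        have h4 : w ⬝ᵥ e = h ⬝ᵥ e - e ⬝ᵥ e := by rw [hw, sub_dotProduct]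
        have h5 := dotProduct_comm e h
        linarith
      rw [h1, smul_smul]
      have : 2 / (w ⬝ᵥ w) * (w ⬝ᵥ h) = 1 := by
        rw [h2] at hw0 ⊢
        have : w ⬝ᵥ h ≠ 0 := fun h0 => hw0 (by rw [h0]; simp)
        field_simp
      rw [this, one_smul, hw]
      abel

/-! ### The edge of the Gaussian orthogonal ensemble -/

/-- The corner, the symmetrised border and the remaining block of a square matrix. -/
def splitCorner {k : ℕ} (A : Fin (k + 1) × Fin (k + 1) → ℝ) :
    Fin k ⊕ (Unit ⊕ Fin k × Fin k) → ℝ :=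
  Sum.elim (fun i => (A (0, i.succ) + A (i.succ, 0)) / √2)
    (Sum.elim (fun _ => A (0, 0)) (fun p => A (p.1.succ, p.2.succ)))

theorem measurable_splitCorner {k : ℕ} : Measurable (splitCorner (k := k)) := by
  refine measurable_pi_lambda _ ?_
  rintro (i | i | p) <;> simp only [splitCorner, Sum.elim_inl, Sum.elim_inr] <;> fun_prop

/-- For a Gaussian matrix, the corner, the symmetrised border and the remaining block are independent
standard Gaussian vectors. -/
theorem map_gaussPi_splitCorner {k : ℕ} :
    (gaussPi (Fin (k + 1) × Fin (k + 1))).map splitCorner = gaussPi _ := by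
  have h2 : √2 ^ 2 = (2 : ℝ) := Real.sq_sqrt (by norm_num)
  refine map_gaussPi _ measurable_splitCorner
    (fun T p => Fin.cases (Fin.cases (T (Sum.inr (Sum.inl ()))) (fun j => T (Sum.inl j) / √2) p.2)
      (fun i => Fin.cases (T (Sum.inl i) / √2) (fun j => T (Sum.inr (Sum.inr (i, j)))) p.2) p.1)
    ?_ ?_
  · intro A T
    simp only [splitCorner, Fintype.sum_sum_type, Fintype.sum_prod_type, Fin.sum_univ_succ,
      Fin.cases_zero, Fin.cases_succ, Sum.elim_inl, Sum.elim_inr, Finset.univ_unique,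
      Finset.sum_singleton, Finset.sum_add_distrib, PUnit.default_eq_unit]
    have : ∑ i, T (Sum.inl i) * ((A (0, Fin.succ i) + A (Fin.succ i, 0)) / √2)
        = ∑ i, T (Sum.inl i) / √2 * A (0, Fin.succ i)
          + ∑ i, T (Sum.inl i) / √2 * A (Fin.succ i, 0) := by
      rw [← Finset.sum_add_distrib]
      exact Finset.sum_congr rfl fun i _ => by ring
    rw [this]
    ring
  · intro T
    simp only [Fintype.sum_sum_type, Fintype.sum_prod_type, Fin.sum_univ_succ,
      Fin.cases_zero, Fin.cases_succ, Finset.univ_unique, div_pow, h2,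
      Finset.sum_singleton, Finset.sum_add_distrib, PUnit.default_eq_unit, ← Finset.sum_div]
    ring

/-- The event that the bordered form with corner `√2 a + c`, border `h` and block `√2 A` exceeds
`t` times the squared norm. -/
def borderedSet (k : ℕ) (t c : ℝ) : Set (Fin k ⊕ (Unit ⊕ Fin k × Fin k) → ℝ) :=
  {z | ∃ (x : ℝ) (y : Fin k → ℝ), t * (x ^ 2 + ∑ i, y i ^ 2) <
    (√2 * z (Sum.inr (Sum.inl ())) + c) * x ^ 2 + 2 * x * ∑ i, z (Sum.inl i) * y i
      + √2 * ∑ i, ∑ j, z (Sum.inr (Sum.inr (i, j))) * (y i * y j)}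

theorem isOpen_borderedSet (k : ℕ) (t c : ℝ) : IsOpen (borderedSet k t c) := by
  simp only [borderedSet, Set.ofPred_exists]
  exact isOpen_iUnion fun x => isOpen_iUnion fun y => isOpen_lt (by fun_prop) (by fun_prop)

theorem spikedSet_single_subset {k : ℕ} {t c : ℝ} (hc : 0 ≤ c) :
    spikedSet t (Pi.single (0 : Fin (k + 1)) c) ⊆ splitCorner ⁻¹' borderedSet k t c := by
  rintro A ⟨y, hy⟩
  refine ⟨y 0, fun i => y i.succ, ?_⟩
  have hspike : (∑ i, (Pi.single (0 : Fin (k + 1)) c : Fin (k + 1) → ℝ) i * y i) ^ 2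
      / √(∑ i, (Pi.single (0 : Fin (k + 1)) c : Fin (k + 1) → ℝ) i ^ 2) = c * y 0 ^ 2 := by
    simp only [Fin.sum_univ_succ, Pi.single_eq_same, ne_eq, Fin.succ_ne_zero, not_false_eq_true,
      Pi.single_eq_of_ne, zero_mul, Finset.sum_const_zero, add_zero, zero_pow, OfNat.ofNat_ne_zero,
      Real.sqrt_sq hc]
    rcases hc.eq_or_lt with rfl | hc
    · simp
    · field_simp
  rw [hspike] at hy
  have h2 : √2 * √2 = (2 : ℝ) := Real.mul_self_sqrt (by norm_num)
  have hb : 2 * y 0 * ∑ i : Fin k, (A (0, i.succ) + A (i.succ, 0)) / √2 * y i.succ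
      = √2 * (∑ i : Fin k, A (0, i.succ) * (y 0 * y i.succ)
        + ∑ i : Fin k, A (i.succ, 0) * (y i.succ * y 0)) := by
    rw [← Finset.sum_add_distrib, Finset.mul_sum, Finset.mul_sum]
    refine Finset.sum_congr rfl fun i _ => ?_
    nth_rewrite 1 [← h2]
    field_simp
  simp only [splitCorner, Sum.elim_inl, Sum.elim_inr]
  rw [hb]
  simp only [Fin.sum_univ_succ, Finset.sum_add_distrib] at hy
  refine hy.trans_eq' ?_ |>.trans_eq ?_ <;> ring

/-- A border `h` of a quadratic form costs at most `‖h‖` in the corner and a rank one term of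
norm `‖h‖` in the remaining block. -/
theorem borderedSet_section_subset {k : ℕ} {t c : ℝ} (h : Fin k → ℝ) :
    {w : Unit ⊕ Fin k × Fin k → ℝ | Sum.elim h w ∈ borderedSet k t c} ⊆
      (fun w _ => w (Sum.inl ())) ⁻¹' {a : Unit → ℝ | t - c - √(∑ i, h i ^ 2) < √2 * a ()} ∪
      (fun w p => w (Sum.inr p)) ⁻¹' spikedSet t h := by
  rintro w ⟨x, y, hxy⟩
  simp only [Sum.elim_inl, Sum.elim_inr] at hxy
  rw [Set.mem_union, or_iff_not_imp_left]
  intro ha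
  simp only [Set.mem_preimage, Set.mem_ofPred_eq, not_lt] at ha
  refine ⟨y, ?_⟩
  have hN2 : √(∑ i, h i ^ 2) ^ 2 = ∑ i, h i ^ 2 := Real.sq_sqrt (by positivity)
  have hcs := Finset.sum_mul_sq_le_sq_mul_sq Finset.univ h y
  rw [← hN2] at hcs
  set N := √(∑ i, h i ^ 2)
  set q := ∑ i, h i * y i
  have hN : 0 ≤ N := Real.sqrt_nonneg _
  have hcross : 2 * x * q ≤ N * x ^ 2 + q ^ 2 / N := by
    rcases hN.eq_or_lt with h0 | hN
    · have : q = 0 := by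
        rw [← h0] at hcs
        have := sq_nonneg q
        exact pow_eq_zero_iff two_ne_zero |>.1 (by nlinarith)
      simp [this, ← h0]
    · have : N * x ^ 2 + q ^ 2 / N - 2 * x * q = (N * x - q) ^ 2 / N := by
        field_simp; ring
      have : 0 ≤ (N * x - q) ^ 2 / N := by positivity
      linarith
  have := mul_le_mul_of_nonneg_right ha (sq_nonneg x)
  linarith

theorem gaussPi_unit_tail (lam s : ℝ) (hlam : 0 < lam) :
    gaussPi Unit {a | s < √2 * a ()} ≤ ENNReal.ofReal (Real.exp (lam ^ 2 - lam * s)) := by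
  have h := measure_lt_le_of_lintegral_exp (gaussPi Unit) (f := fun a => lam * √2 * a ())
    (by fun_prop) (a := lam * s) (b := lam ^ 2) (by
      rw [lintegral_exp_gaussPi_unit, mul_pow, Real.sq_sqrt (by norm_num)]
      refine le_of_eq ?_
      congr 2
      ring)
  refine le_trans (measure_mono ?_) h
  intro a ha
  have := mul_lt_mul_of_pos_left ha hlam
  simpa [mul_assoc] using this

/-- The edge of the Gaussian orthogonal ensemble with a rank one perturbation, by induction on the
dimension: after a rotation the perturbation sits in the corner, and removing the corner leaves a
matrix of the same kind in the remaining block. -/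
theorem gaussPi_spikedSet_le {D lam t : ℝ} (hD : 0 < D) (hlam : 0 < lam) (k : ℕ) (hk : (k : ℝ) ≤ D)
    (h : Fin k → ℝ) :
    gaussPi _ (spikedSet t h) ≤ ENNReal.ofReal
      (Real.exp (lam * √(∑ i, h i ^ 2) + 3 / 2 * lam ^ 2 + lam * √D - lam * t)
        + k * Real.exp (2 * lam ^ 2 + 2 * lam * √D - lam * t)) := by
  induction k with
  | zero =>
    have : spikedSet t h = ∅ := by
      ext A
      simp [spikedSet]
    simp [this]
  | succ k ih =>
    have hk' : (k : ℝ) ≤ D := by push_cast at hk; linarith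
    obtain ⟨O, hO, hOh⟩ := exists_orthogonal_mulVec_eq h
    set c := √(∑ i, h i ^ 2)
    have hc : 0 ≤ c := Real.sqrt_nonneg _
    set e₁ := Real.exp (3 / 2 * lam ^ 2 + lam * √D - lam * t)
    set e₂ := Real.exp (2 * lam ^ 2 + 2 * lam * √D - lam * t)
    set e₃ := Real.exp (lam ^ 2 - lam * (t - c))
    have hsec : ∀ h' : Fin k → ℝ,
        gaussPi _ {w : Unit ⊕ Fin k × Fin k → ℝ | Sum.elim h' w ∈ borderedSet k t c}
        ≤ ENNReal.ofReal (e₃ + e₁) * ENNReal.ofReal (Real.exp (lam * √(∑ i, h' i ^ 2)))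
          + ENNReal.ofReal (k * e₂) := by
      intro h'
      refine (measure_mono (borderedSet_section_subset h')).trans ?_
      refine (measure_union_le _ _).trans ?_
      have hm₁ : MeasurableSet {a : Unit → ℝ | t - c - √(∑ i, h' i ^ 2) < √2 * a ()} :=
        measurableSet_lt (by fun_prop) (by fun_prop)
      rw [← Measure.map_apply (by fun_prop) hm₁,
        ← Measure.map_apply (by fun_prop) (isOpen_spikedSet t h').measurableSet,
        map_gaussPi_comp (fun _ : Unit => (Sum.inl () : Unit ⊕ Fin k × Fin k))
          (fun _ _ _ => rfl),
        map_gaussPi_comp (fun p => (Sum.inr p : Unit ⊕ Fin k × Fin k)) Sum.inr_injective]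
      refine (add_le_add (gaussPi_unit_tail lam _ hlam) (ih hk' h')).trans ?_
      rw [← ENNReal.ofReal_add (by positivity) (by positivity),
        ← ENNReal.ofReal_mul (by positivity), ← ENNReal.ofReal_add (by positivity) (by positivity)]
      refine ENNReal.ofReal_le_ofReal (le_of_eq ?_)
      rw [add_mul, ← Real.exp_add, ← Real.exp_add]
      ring_nf
    have hprod : gaussPi _ (borderedSet k t c) ≤
        ∫⁻ h', gaussPi _ {w : Unit ⊕ Fin k × Fin k → ℝ | Sum.elim h' w ∈ borderedSet k t c}
          ∂gaussPi (Fin k) := by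
      have hm : Measurable fun p : (Fin k → ℝ) × (Unit ⊕ Fin k × Fin k → ℝ) =>
          (Sum.elim p.1 p.2 : Fin k ⊕ (Unit ⊕ Fin k × Fin k) → ℝ) := by
        refine measurable_pi_lambda _ ?_
        rintro (i | i) <;> simp only [Sum.elim_inl, Sum.elim_inr] <;> fun_prop
      rw [← map_gaussPi_sum, Measure.map_apply hm (isOpen_borderedSet k t c).measurableSet,
        Measure.prod_apply (hm (isOpen_borderedSet k t c).measurableSet)]
      exact le_rfl
    calc gaussPi _ (spikedSet t h) ≤ gaussPi _ (spikedSet t (Pi.single (0 : Fin (k + 1)) c)) :=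
          hOh ▸ gaussPi_spikedSet_le_rotate t h hO
      _ ≤ gaussPi _ (splitCorner ⁻¹' borderedSet k t c) :=
          measure_mono (spikedSet_single_subset hc)
      _ = gaussPi _ (borderedSet k t c) := by
          rw [← Measure.map_apply measurable_splitCorner (isOpen_borderedSet k t c).measurableSet,
            map_gaussPi_splitCorner]
      _ ≤ ∫⁻ h', (ENNReal.ofReal (e₃ + e₁) * ENNReal.ofReal (Real.exp (lam * √(∑ i, h' i ^ 2)))
          + ENNReal.ofReal (k * e₂)) ∂gaussPi (Fin k) := hprod.trans (lintegral_mono hsec)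
      _ ≤ ENNReal.ofReal (e₃ + e₁) * ENNReal.ofReal (Real.exp (lam * √D + lam ^ 2 / 2))
          + ENNReal.ofReal (k * e₂) := by
          rw [lintegral_add_right _ measurable_const, lintegral_const, measure_univ, mul_one,
            lintegral_const_mul _ (by fun_prop)]
          gcongr
          exact lintegral_exp_norm_gaussPi hD (by simpa using hk') hlam.le
      _ = _ := by
          rw [← ENNReal.ofReal_mul (by positivity),
            ← ENNReal.ofReal_add (by positivity) (by positivity)]
          congr 1
          rw [add_mul, ← Real.exp_add, ← Real.exp_add]
          push_cast
          simp only [e₂]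
          ring_nf

/-- The upper edge of the Gaussian orthogonal ensemble. -/
theorem gaussPi_edge {d : ℕ} (hd : 0 < d) {s : ℝ} (hs : 0 < s) :
    gaussPi _ {A : Fin d × Fin d → ℝ | ∃ y : Fin d → ℝ,
        (2 * √(d : ℝ) + s) * ∑ i, y i ^ 2 < √2 * ∑ i, ∑ j, A (i, j) * (y i * y j)}
      ≤ ENNReal.ofReal ((d + 1) * Real.exp (-s ^ 2 / 8)) := by
  have hd0 : (0 : ℝ) < d := by exact_mod_cast hd
  -- The exponent `s / 4` minimises the bound `2 lam ^ 2 - lam * s`.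
  have h := gaussPi_spikedSet_le (t := 2 * √(d : ℝ) + s) hd0 (by positivity : 0 < s / 4) d le_rfl 0
  have hset : spikedSet (2 * √(d : ℝ) + s) (0 : Fin d → ℝ) = {A | ∃ y : Fin d → ℝ,
      (2 * √(d : ℝ) + s) * ∑ i, y i ^ 2 < √2 * ∑ i, ∑ j, A (i, j) * (y i * y j)} := by
    simp [spikedSet]
  rw [hset] at h
  refine h.trans (ENNReal.ofReal_le_ofReal ?_)
  rw [add_mul, one_mul, add_comm]
  have hs0 := Real.sqrt_nonneg (d : ℝ)
  refine add_le_add (le_of_eq ?_) (Real.exp_le_exp.2 ?_)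
  · congr 2
    ring
  · simp
    nlinarith [mul_nonneg hs.le hs0]

/-! ### Symmetric Gaussian matrices with independent entries -/

theorem sum_sum_eq_sum_upperIdx {d : ℕ} (G : Fin d → Fin d → ℝ) :
    ∑ i, ∑ j, G i j = ∑ p : UpperIdx d, G p.1.1 p.1.2
      + ∑ p : UpperIdx d, if p.1.1 = p.1.2 then 0 else G p.1.2 p.1.1 := by
  rw [← Fintype.sum_prod_type' (f := G),
    ← Finset.sum_filter_add_sum_filter_not Finset.univ (fun p : Fin d × Fin d => p.1 ≤ p.2)]
  congr 1
  · exact Finset.sum_subtype _ (by simp) _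
  · rw [← Finset.sum_subtype (s := Finset.univ.filter fun p : Fin d × Fin d => p.1 ≤ p.2) (by simp)
      (fun p : Fin d × Fin d => if p.1 = p.2 then 0 else G p.2 p.1)]
    simp_rw [← ite_not (p := _ = _)]
    rw [← Finset.sum_filter, Finset.filter_filter]
    refine Finset.sum_nbij' Prod.swap Prod.swap ?_ ?_ ?_ ?_ ?_
    · rintro ⟨i, j⟩ h
      simp at h ⊢
      exact ⟨h.le, h.ne⟩
    · rintro ⟨i, j⟩ h
      simp at h ⊢
      exact lt_of_le_of_ne h.1 h.2
    all_goals simp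

theorem sum_diag_eq_sum_upperIdx {d : ℕ} (F : Fin d → ℝ) :
    ∑ i, F i = ∑ p : UpperIdx d, if p.1.1 = p.1.2 then F p.1.1 else 0 := by
  rw [← Finset.sum_filter]
  refine Finset.sum_bij' (fun i _ => (⟨(i, i), le_rfl⟩ : UpperIdx d)) (fun p _ => p.1.1)
    (by simp) (by simp) (by simp) ?_ (by simp)
  rintro ⟨⟨i, j⟩, h⟩ hp
  simp at hp
  simp [hp]

theorem symMatrix_upperIdx {d : ℕ} (g : UpperIdx d → ℝ) (p : UpperIdx d) :
    symMatrix g p.1.1 p.1.2 = g p := by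
  obtain ⟨⟨i, j⟩, h⟩ := p
  simp only [symMatrix, Matrix.of_apply]
  congr 1
  simp only [Subtype.mk.injEq, Prod.mk.injEq]
  exact ⟨min_eq_left h, max_eq_right h⟩

theorem symMatrix_comm {d : ℕ} (g : UpperIdx d → ℝ) (i j : Fin d) :
    symMatrix g i j = symMatrix g j i := by
  simp [symMatrix, min_comm, max_comm]

/-- The symmetrisation of a square matrix, with its diagonal, of variance `2`, split with the help of
an additional vector into a sum of two independent parts of variance `1`. -/
def symmetrizeSplit {d : ℕ} (x : (Fin d × Fin d) ⊕ Fin d → ℝ) : UpperIdx d ⊕ Fin d → ℝ :=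
  Sum.elim
    (fun p => (x (Sum.inl p.1)
      + if p.1.1 = p.1.2 then x (Sum.inr p.1.1) else x (Sum.inl (p.1.2, p.1.1))) / √2)
    (fun i => (x (Sum.inl (i, i)) - x (Sum.inr i)) / √2)

theorem measurable_symmetrizeSplit {d : ℕ} : Measurable (symmetrizeSplit (d := d)) := by
  refine measurable_pi_lambda _ ?_
  rintro (p | i) <;> simp only [symmetrizeSplit, Sum.elim_inl, Sum.elim_inr]
  · split_ifs <;> fun_prop
  · fun_prop

theorem map_gaussPi_symmetrizeSplit {d : ℕ} :
    (gaussPi ((Fin d × Fin d) ⊕ Fin d)).map symmetrizeSplit = gaussPi (UpperIdx d ⊕ Fin d) := by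
  have h2 : √2 ^ 2 = (2 : ℝ) := Real.sq_sqrt (by norm_num)
  refine map_gaussPi _ measurable_symmetrizeSplit
    (fun t => Sum.elim (fun q => (symMatrix (fun p => t (Sum.inl p)) q.1 q.2
        + if q.1 = q.2 then t (Sum.inr q.1) else 0) / √2)
      (fun i => (symMatrix (fun p => t (Sum.inl p)) i i - t (Sum.inr i)) / √2)) ?_ ?_
  · intro x t
    set S := symMatrix (fun p => t (Sum.inl p)) with hS
    have hSp : ∀ p : UpperIdx d, S p.1.1 p.1.2 = t (Sum.inl p) := fun p => by
      rw [hS, symMatrix_upperIdx]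
    have hSc : ∀ i j, S i j = S j i := symMatrix_comm _
    have e1 := sum_sum_eq_sum_upperIdx fun i j => S i j * x (Sum.inl (i, j))
    have e2 := sum_diag_eq_sum_upperIdx fun i => S i i * x (Sum.inr i)
    have e3 : ∀ p : UpperIdx d, t (Sum.inl p) * ((x (Sum.inl p.1)
        + if p.1.1 = p.1.2 then x (Sum.inr p.1.1) else x (Sum.inl (p.1.2, p.1.1))) / √2)
        = (S p.1.1 p.1.2 * x (Sum.inl (p.1.1, p.1.2))
          + (if p.1.1 = p.1.2 then 0 else S p.1.2 p.1.1 * x (Sum.inl (p.1.2, p.1.1)))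
          + (if p.1.1 = p.1.2 then S p.1.1 p.1.1 * x (Sum.inr p.1.1) else 0)) / √2 := by
      intro p
      have hx : x (Sum.inl p.1) = x (Sum.inl (p.1.1, p.1.2)) := rfl
      rw [hSc p.1.2, ← hSp, hx]
      split_ifs with hp
      · rw [← hp]; ring
      · ring
    simp only [symmetrizeSplit, Fintype.sum_sum_type, Sum.elim_inl, Sum.elim_inr]
    simp_rw [e3]
    rw [← Finset.sum_div, Finset.sum_add_distrib, Finset.sum_add_distrib, ← e1, ← e2,
      Fintype.sum_prod_type]
    have e4 : ∀ i j, (S i j + if i = j then t (Sum.inr i) else 0) / √2 * x (Sum.inl (i, j))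
        = S i j * x (Sum.inl (i, j)) / √2
          + if i = j then t (Sum.inr i) * x (Sum.inl (i, i)) / √2 else 0 := by
      intro i j
      split_ifs with h
      · rw [h]; ring
      · ring
    simp_rw [e4, Finset.sum_add_distrib]
    simp only [Finset.sum_ite_eq, Finset.mem_univ, if_true]
    simp only [← Finset.sum_div, add_div, sub_div, mul_sub, sub_mul, div_mul_eq_mul_div,
      mul_div_assoc', Finset.sum_sub_distrib]
    ring
  · intro t
    set S := symMatrix (fun p => t (Sum.inl p)) with hS
    have hSp : ∀ p : UpperIdx d, S p.1.1 p.1.2 = t (Sum.inl p) := fun p => by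
      rw [hS, symMatrix_upperIdx]
    have hSc : ∀ i j, S i j = S j i := symMatrix_comm _
    have e1 := sum_sum_eq_sum_upperIdx fun i j => S i j ^ 2
    have e2 := sum_diag_eq_sum_upperIdx fun i => S i i ^ 2
    have e3 : ∀ p : UpperIdx d, t (Sum.inl p) ^ 2 = (S p.1.1 p.1.2 ^ 2
          + (if p.1.1 = p.1.2 then 0 else S p.1.2 p.1.1 ^ 2)
          + (if p.1.1 = p.1.2 then S p.1.1 p.1.1 ^ 2 else 0)) / 2 := by
      intro p
      rw [hSc p.1.2, ← hSp]
      split_ifs with hp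
      · rw [← hp]; ring
      · ring
    simp only [Fintype.sum_sum_type, Sum.elim_inl, Sum.elim_inr]
    simp_rw [e3]
    rw [← Finset.sum_div, Finset.sum_add_distrib, Finset.sum_add_distrib, ← e1, ← e2,
      Fintype.sum_prod_type]
    have e4 : ∀ i j, ((S i j + if i = j then t (Sum.inr i) else 0) / √2) ^ 2
        = S i j ^ 2 / 2
          + if i = j then (2 * S i i * t (Sum.inr i) + t (Sum.inr i) ^ 2) / 2 else 0 := by
      intro i j
      rw [div_pow, h2]
      split_ifs with h
      · rw [h]; ring
      · ring
    have e5 : ∀ i, ((S i i - t (Sum.inr i)) / √2) ^ 2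
        = S i i ^ 2 / 2 - (2 * S i i * t (Sum.inr i) + t (Sum.inr i) ^ 2) / 2
          + t (Sum.inr i) ^ 2 := by
      intro i
      rw [div_pow, h2]
      ring
    simp_rw [e4, e5, Finset.sum_add_distrib]
    simp only [Finset.sum_ite_eq, Finset.mem_univ, if_true]
    simp only [← Finset.sum_div, Finset.sum_sub_distrib]
    ring

theorem quadForm_symmetrizeSplit {d : ℕ} (x : (Fin d × Fin d) ⊕ Fin d → ℝ) (y : Fin d → ℝ) :
    ∑ i, ∑ j, symMatrix (fun p => symmetrizeSplit x (Sum.inl p)) i j * (y i * y j)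
        + ∑ i, symmetrizeSplit x (Sum.inr i) * y i ^ 2
      = √2 * ∑ i, ∑ j, x (Sum.inl (i, j)) * (y i * y j) := by
  have e1 : ∀ i j, symMatrix (fun p => symmetrizeSplit x (Sum.inl p)) i j * (y i * y j)
      = x (Sum.inl (i, j)) * (y i * y j) / √2 + x (Sum.inl (j, i)) * (y j * y i) / √2
        + if i = j then (x (Sum.inr i) - x (Sum.inl (i, i))) / √2 * y i ^ 2 else 0 := by
    intro i j
    simp only [symMatrix, Matrix.of_apply, symmetrizeSplit, Sum.elim_inl]
    rcases lt_trichotomy i j with h | h | h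
    · rw [min_eq_left h.le, max_eq_right h.le, if_neg h.ne, if_neg h.ne]; ring
    · subst h
      simp only [min_self, max_self, if_true]; ring
    · rw [min_eq_right h.le, max_eq_left h.le, if_neg h.ne, if_neg h.ne']; ring
  simp_rw [e1, Finset.sum_add_distrib]
  rw [Finset.sum_comm (f := fun i j => x (Sum.inl (j, i)) * (y j * y i) / √2)]
  simp only [Finset.sum_ite_eq, Finset.mem_univ, if_true, symmetrizeSplit, Sum.elim_inr]
  have e2 : ∑ i, (x (Sum.inr i) - x (Sum.inl (i, i))) / √2 * y i ^ 2
      = -∑ i, (x (Sum.inl (i, i)) - x (Sum.inr i)) / √2 * y i ^ 2 := by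
    rw [← Finset.sum_neg_distrib]
    exact Finset.sum_congr rfl fun i _ => by ring
  rw [e2]
  simp only [← Finset.sum_div]
  set q := ∑ i, ∑ j, x (Sum.inl (i, j)) * (y i * y j)
  have : √2 * q = q / √2 + q / √2 := by
    field_simp
    rw [Real.sq_sqrt (by norm_num)]
    ring
  rw [this]
  ring

/-- A centred Gaussian variable is nonnegative with probability at least one half. -/
theorem half_le_gaussPi_nonneg {ι : Type*} [Fintype ι] (w : ι → ℝ) :
    1 ≤ 2 * gaussPi ι {x | 0 ≤ ∑ i, x i * w i} := by
  set S := {x : ι → ℝ | 0 ≤ ∑ i, x i * w i} with hS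
  have hm : MeasurableSet S := measurableSet_le (by fun_prop) (by fun_prop)
  have hneg : gaussPi ι ((fun x => -x) ⁻¹' S) = gaussPi ι S := by
    rw [← Measure.map_apply (by fun_prop) hm, map_gaussPi_neg]
  calc (1 : ENNReal) = gaussPi ι Set.univ := measure_univ.symm
    _ ≤ gaussPi ι (S ∪ (fun x => -x) ⁻¹' S) := by
        refine measure_mono fun x _ => ?_
        rcases le_total 0 (∑ i, x i * w i) with h | h
        · exact Or.inl h
        · refine Or.inr ?_
          simp only [hS, Set.mem_preimage, Set.mem_ofPred_eq, Pi.neg_apply, neg_mul,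
            Finset.sum_neg_distrib]
          linarith
    _ ≤ gaussPi ι S + gaussPi ι ((fun x => -x) ⁻¹' S) := measure_union_le _ _
    _ = 2 * gaussPi ι S := by rw [hneg, two_mul]

/-- The event that the largest eigenvalue of `symMatrix g` exceeds `t`. -/
def wignerSet (d : ℕ) (t : ℝ) : Set (UpperIdx d → ℝ) :=
  {g | ∃ y : Fin d → ℝ, t * ∑ i, y i ^ 2 < ∑ i, ∑ j, symMatrix g i j * (y i * y j)}

theorem isOpen_wignerSet (d : ℕ) (t : ℝ) : IsOpen (wignerSet d t) := by
  simp only [wignerSet, Set.ofPred_exists, symMatrix, Matrix.of_apply]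
  exact isOpen_iUnion fun y => isOpen_lt (by fun_prop) (by fun_prop)

/-- Adding an independent diagonal noise to `symMatrix g` gives the Gaussian orthogonal ensemble, and
by symmetry it does not decrease the form at a given top eigenvector with probability one half. -/
theorem gaussPi_wignerSet_le (d : ℕ) (t : ℝ) :
    gaussPi _ (wignerSet d t) ≤ 2 * gaussPi _ {A : Fin d × Fin d → ℝ | ∃ y : Fin d → ℝ,
        t * ∑ i, y i ^ 2 < √2 * ∑ i, ∑ j, A (i, j) * (y i * y j)} := by
  set E : Set (UpperIdx d ⊕ Fin d → ℝ) := {z | ∃ y : Fin d → ℝ, t * ∑ i, y i ^ 2 <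
    ∑ i, ∑ j, symMatrix (fun p => z (Sum.inl p)) i j * (y i * y j)
      + ∑ i, z (Sum.inr i) * y i ^ 2} with hE
  have hEo : IsOpen E := by
    simp only [hE, Set.ofPred_exists, symMatrix, Matrix.of_apply]
    exact isOpen_iUnion fun y => isOpen_lt (by fun_prop) (by fun_prop)
  set F := {A : Fin d × Fin d → ℝ | ∃ y : Fin d → ℝ,
        t * ∑ i, y i ^ 2 < √2 * ∑ i, ∑ j, A (i, j) * (y i * y j)} with hF
  have hFo : IsOpen F := by
    simp only [hF, Set.ofPred_exists]
    exact isOpen_iUnion fun y => isOpen_lt (by fun_prop) (by fun_prop)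
  have hEF : gaussPi _ E = gaussPi _ F := by
    rw [← map_gaussPi_symmetrizeSplit, Measure.map_apply measurable_symmetrizeSplit
      hEo.measurableSet,
      ← map_gaussPi_comp (fun p => (Sum.inl p : (Fin d × Fin d) ⊕ Fin d)) Sum.inl_injective,
      Measure.map_apply (by fun_prop) hFo.measurableSet]
    congr 1
    ext x
    simp only [hE, hF, Set.mem_preimage, Set.mem_ofPred_eq, quadForm_symmetrizeSplit]
  have hm : Measurable fun p : (UpperIdx d → ℝ) × (Fin d → ℝ) =>
      (Sum.elim p.1 p.2 : UpperIdx d ⊕ Fin d → ℝ) := by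
    refine measurable_pi_lambda _ ?_
    rintro (i | i) <;> simp only [Sum.elim_inl, Sum.elim_inr] <;> fun_prop
  have hprod : gaussPi _ E = ∫⁻ g, gaussPi _ {g' : Fin d → ℝ | Sum.elim g g' ∈ E}
      ∂gaussPi (UpperIdx d) := by
    rw [← map_gaussPi_sum, Measure.map_apply hm hEo.measurableSet,
      Measure.prod_apply (hm hEo.measurableSet)]
    rfl
  have hmeas : Measurable fun g => gaussPi _ {g' : Fin d → ℝ | Sum.elim g g' ∈ E} :=
    measurable_measure_prodMk_left (hm hEo.measurableSet)
  calc gaussPi _ (wignerSet d t) = ∫⁻ g in wignerSet d t, 1 ∂gaussPi (UpperIdx d) := by simp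
    _ ≤ ∫⁻ g in wignerSet d t, 2 * gaussPi _ {g' : Fin d → ℝ | Sum.elim g g' ∈ E}
          ∂gaussPi (UpperIdx d) := by
        refine setLIntegral_mono (hmeas.const_mul _) ?_
        rintro g ⟨y, hy⟩
        refine (half_le_gaussPi_nonneg fun i => y i ^ 2).trans ?_
        refine mul_le_mul_right (measure_mono ?_) _
        intro x hx
        refine ⟨y, ?_⟩
        simp only [Sum.elim_inl, Sum.elim_inr]
        have : 0 ≤ ∑ i, x i * y i ^ 2 := hx
        linarith
    _ ≤ ∫⁻ g, 2 * gaussPi _ {g' : Fin d → ℝ | Sum.elim g g' ∈ E} ∂gaussPi (UpperIdx d) :=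
        setLIntegral_le_lintegral _ _
    _ = 2 * gaussPi _ F := by rw [lintegral_const_mul _ hmeas, ← hprod, hEF]

/-- The operator norm of a symmetric Gaussian matrix with independent standard entries on and above
the diagonal. -/
theorem gaussPi_wigner_opNorm {d : ℕ} (hd : 0 < d) {s : ℝ} (hs : 0 < s) :
    gaussPi _ {g : UpperIdx d → ℝ | ∃ y : Fin d → ℝ, (2 * √(d : ℝ) + s) * ∑ i, y i ^ 2 <
        |∑ i, ∑ j, symMatrix g i j * (y i * y j)|}
      ≤ ENNReal.ofReal (4 * (d + 1) * Real.exp (-s ^ 2 / 8)) := by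
  set t := 2 * √(d : ℝ) + s
  have hneg : gaussPi _ ((fun g => -g) ⁻¹' wignerSet d t) = gaussPi _ (wignerSet d t) := by
    rw [← Measure.map_apply (by fun_prop) (isOpen_wignerSet d t).measurableSet, map_gaussPi_neg]
  calc _ ≤ gaussPi _ (wignerSet d t ∪ (fun g => -g) ⁻¹' wignerSet d t) := by
        refine measure_mono ?_
        rintro g ⟨y, hy⟩
        rcases lt_abs.1 hy with h | h
        · exact Or.inl ⟨y, h⟩
        · refine Or.inr ⟨y, ?_⟩
          have : ∀ i j, symMatrix (-g) i j = -symMatrix g i j := fun i j => rfl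
          simpa only [this, neg_mul, Finset.sum_neg_distrib] using h
    _ ≤ 2 * gaussPi _ (wignerSet d t) := by
        rw [two_mul]
        nth_rewrite 2 [← hneg]
        exact measure_union_le _ _
    _ ≤ 2 * (2 * ENNReal.ofReal ((d + 1) * Real.exp (-s ^ 2 / 8))) := by
        gcongr
        exact (gaussPi_wignerSet_le d t).trans (mul_le_mul_right (gaussPi_edge hd hs) _)
    _ = _ := by
        rw [← mul_assoc, mul_assoc 4, ENNReal.ofReal_mul (by norm_num : (0 : ℝ) ≤ 4)]
        norm_num

/-! ### Perturbation of the eigenvectors -/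

theorem frobNorm_sq {d : ℕ} (A : Matrix (Fin d) (Fin d) ℝ) : frobNorm A ^ 2 = (Aᵀ * A).trace := by
  rw [← sum_mul_entries_eq_trace, Fintype.sum_prod_type, frobNorm, Matrix.frobenius_norm_def,
    ← Real.sqrt_eq_rpow, Real.sq_sqrt (by positivity)]
  simp [sq]

theorem frobNorm_nonneg {d : ℕ} (A : Matrix (Fin d) (Fin d) ℝ) : 0 ≤ frobNorm A := by
  let _ := Matrix.frobeniusNormedAddCommGroup (m := Fin d) (n := Fin d) (α := ℝ)
  exact norm_nonneg A

theorem frobNorm_add_le {d : ℕ} (A B : Matrix (Fin d) (Fin d) ℝ) :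
    frobNorm (A + B) ≤ frobNorm A + frobNorm B := by
  let _ := Matrix.frobeniusNormedAddCommGroup (m := Fin d) (n := Fin d) (α := ℝ)
  exact norm_add_le A B

theorem sortedEigenvalues_antitone {d : ℕ} {A : Matrix (Fin d) (Fin d) ℝ} (hA : A.IsHermitian) :
    Antitone (sortedEigenvalues hA) := fun _ _ hij =>
  hA.eigenvalues₀_antitone (by simpa using hij)

/-- The squared entries of an orthogonal matrix form a doubly stochastic matrix. -/
theorem sq_mem_doublyStochastic {d : ℕ} {R : Matrix (Fin d) (Fin d) ℝ} (hR : Rᵀ * R = 1) :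
    (Matrix.of fun i j => R i j ^ 2) ∈ doublyStochastic ℝ (Fin d) := by
  have hR' : R * Rᵀ = 1 := mul_eq_one_comm.1 hR
  rw [mem_doublyStochastic_iff_sum]
  refine ⟨fun i j => sq_nonneg _, fun i => ?_, fun j => ?_⟩
  · have := congrFun (congrFun hR' i) i
    simpa [Matrix.mul_apply, sq] using this
  · have := congrFun (congrFun hR j) j
    simpa [Matrix.mul_apply, sq] using this

/-- Von Neumann's trace inequality: by Birkhoff's theorem it reduces to the rearrangement
inequality. -/
theorem trace_mul_le_sum_mul {d : ℕ} {P Q : Matrix (Fin d) (Fin d) ℝ} (hP : Pᵀ * P = 1)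
    (hQ : Qᵀ * Q = 1) {a b : Fin d → ℝ} (ha : Antitone a) (hb : Antitone b) :
    ((Q * diagonal a * Qᵀ) * (P * diagonal b * Pᵀ)).trace ≤ ∑ i, a i * b i := by
  set R := Qᵀ * P with hRdef
  have hR : Rᵀ * R = 1 := by
    rw [hRdef, Matrix.transpose_mul, Matrix.transpose_transpose, Matrix.mul_assoc,
      ← Matrix.mul_assoc Q, mul_eq_one_comm.1 hQ, Matrix.one_mul, hP]
  have htr : ((Q * diagonal a * Qᵀ) * (P * diagonal b * Pᵀ)).trace
      = ∑ i, ∑ j, a i * b j * R i j ^ 2 := by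
    have h1 : ((Q * diagonal a * Qᵀ) * (P * diagonal b * Pᵀ)).trace
        = ((diagonal a * R) * (diagonal b * Rᵀ)).trace := by
      rw [hRdef, Matrix.transpose_mul, Matrix.transpose_transpose]
      simp only [Matrix.mul_assoc]
      rw [Matrix.trace_mul_comm]
      simp only [Matrix.mul_assoc]
    rw [h1, Matrix.trace]
    refine Finset.sum_congr rfl fun i _ => ?_
    rw [Matrix.diag_apply, Matrix.mul_apply]
    refine Finset.sum_congr rfl fun j _ => ?_
    rw [Matrix.diagonal_mul, Matrix.diagonal_mul, Matrix.transpose_apply]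
    ring
  obtain ⟨w, hw0, hw1, hw⟩ := exists_eq_sum_perm_of_mem_doublyStochastic (sq_mem_doublyStochastic hR)
  have hentry : ∀ i j, R i j ^ 2 = ∑ σ, w σ * σ.permMatrix ℝ i j := by
    intro i j
    have := congrFun (congrFun hw i) j
    simp only [Matrix.sum_apply, Matrix.smul_apply, smul_eq_mul, Matrix.of_apply] at this
    exact this.symm
  have hperm : ∀ σ : Equiv.Perm (Fin d), ∑ i, ∑ j, a i * b j * σ.permMatrix ℝ i j
      = ∑ i, a i * b (σ i) := by
    intro σ
    refine Finset.sum_congr rfl fun i _ => ?_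
    simp [Equiv.Perm.permMatrix, PEquiv.toMatrix_apply]
  have hmono : Monovary a b := fun i j hij => ha (hb.reflect_lt hij).le
  calc _ = ∑ σ, w σ * ∑ i, ∑ j, a i * b j * σ.permMatrix ℝ i j := by
        rw [htr]
        simp_rw [hentry, Finset.mul_sum]
        refine ((Finset.sum_congr rfl fun i _ => Finset.sum_comm).trans Finset.sum_comm).trans ?_
        exact Finset.sum_congr rfl fun σ _ => Finset.sum_congr rfl fun i _ =>
          Finset.sum_congr rfl fun j _ => by ring
    _ ≤ ∑ σ, w σ * ∑ i, a i * b i := by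
        refine Finset.sum_le_sum fun σ _ => mul_le_mul_of_nonneg_left ?_ (hw0 σ)
        rw [hperm]
        exact hmono.sum_mul_comp_perm_le_sum_mul
    _ = _ := by rw [← Finset.sum_mul, hw1, one_mul]

theorem abs_trace_conj_diagonal_mul_le {d : ℕ} {P E : Matrix (Fin d) (Fin d) ℝ} (hP : Pᵀ * P = 1)
    {a : Fin d → ℝ} (ha : ∀ i, 0 ≤ a i) {κ : ℝ}
    (hE : ∀ y : Fin d → ℝ, |∑ i, ∑ j, E i j * (y i * y j)| ≤ κ * ∑ i, y i ^ 2) :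
    |((P * diagonal a * Pᵀ) * E).trace| ≤ κ * ∑ i, a i := by
  have htr : ((P * diagonal a * Pᵀ) * E).trace = ∑ i, a i * (Pᵀ * E * P) i i := by
    rw [Matrix.mul_assoc, Matrix.mul_assoc, Matrix.trace_mul_comm, Matrix.mul_assoc, Matrix.trace]
    refine Finset.sum_congr rfl fun i _ => ?_
    rw [Matrix.diag_apply, Matrix.diagonal_mul]
  rw [htr, Finset.mul_sum]
  refine (Finset.abs_sum_le_sum_abs _ _).trans (Finset.sum_le_sum fun i _ => ?_)
  have hcol : (Pᵀ * E * P) i i = ∑ j, ∑ k, E j k * (P j i * P k i) := by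
    rw [Matrix.mul_apply, Finset.sum_comm]
    refine Finset.sum_congr rfl fun k _ => ?_
    rw [Matrix.mul_apply, Finset.sum_mul]
    refine Finset.sum_congr rfl fun j _ => ?_
    rw [Matrix.transpose_apply]
    ring
  have hnorm : ∑ j, P j i ^ 2 = 1 := by
    have := congrFun (congrFun hP i) i
    simpa [Matrix.mul_apply, sq] using this
  have := hE fun j => P j i
  rw [hnorm, mul_one, ← hcol] at this
  rw [abs_mul, abs_of_nonneg (ha i), mul_comm κ]
  exact mul_le_mul_of_nonneg_left this (ha i)

/-- Replacing the eigenvectors of `Q diag(a) Qᵀ` by those of a perturbation `P diag(b) Pᵀ` costs at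
most the norm `κ` of the perturbation times the trace. The trace inequality says that `P` is the
best choice for the perturbed matrix, and the loss for the original one is a pairing with the
perturbation. -/
theorem frobNorm_conj_diagonal_sub_sq_le {d : ℕ} {P Q E : Matrix (Fin d) (Fin d) ℝ}
    (hP : Pᵀ * P = 1) (hQ : Qᵀ * Q = 1) {a b : Fin d → ℝ} (ha : Antitone a) (hb : Antitone b)
    (ha0 : ∀ i, 0 ≤ a i) (hM : Q * diagonal a * Qᵀ + E = P * diagonal b * Pᵀ) {κ : ℝ}
    (hE : ∀ y : Fin d → ℝ, |∑ i, ∑ j, E i j * (y i * y j)| ≤ κ * ∑ i, y i ^ 2) :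
    frobNorm (P * diagonal a * Pᵀ - Q * diagonal a * Qᵀ) ^ 2 ≤ 4 * κ * ∑ i, a i := by
  have hself : ∀ {R : Matrix (Fin d) (Fin d) ℝ}, Rᵀ * R = 1 → ∀ c : Fin d → ℝ,
      ((R * diagonal a * Rᵀ) * (R * diagonal c * Rᵀ)).trace = ∑ i, a i * c i := by
    intro R hR c
    have : (R * diagonal a * Rᵀ) * (R * diagonal c * Rᵀ)
        = R * (diagonal a * ((Rᵀ * R) * (diagonal c * Rᵀ))) := by simp only [Matrix.mul_assoc]
    rw [this, hR, Matrix.one_mul, Matrix.trace_mul_comm, Matrix.mul_assoc, Matrix.mul_assoc, hR,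
      Matrix.mul_one, Matrix.diagonal_mul_diagonal, Matrix.trace_diagonal]
  have hTE := abs_trace_conj_diagonal_mul_le hP ha0 hE
  have hSE := abs_trace_conj_diagonal_mul_le hQ ha0 hE
  have hTM := hself hP b
  have hSM := trace_mul_le_sum_mul hP hQ ha hb
  have hTT := hself hP a
  have hSS := hself hQ a
  have htr : ∀ R : Matrix (Fin d) (Fin d) ℝ, (R * diagonal a * Rᵀ)ᵀ = R * diagonal a * Rᵀ := by
    intro R
    simp only [Matrix.transpose_mul, Matrix.transpose_transpose, Matrix.diagonal_transpose,
      Matrix.mul_assoc]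
  rw [frobNorm_sq, Matrix.transpose_sub, htr, htr]
  rw [← hM] at hTM hSM
  set T := P * diagonal a * Pᵀ
  set S := Q * diagonal a * Qᵀ
  rw [Matrix.mul_add, Matrix.trace_add] at hTM hSM
  rw [Matrix.sub_mul, Matrix.mul_sub, Matrix.mul_sub, Matrix.trace_sub, Matrix.trace_sub,
    Matrix.trace_sub, Matrix.trace_mul_comm S T]
  have h1 := abs_le.1 hTE
  have h2 := abs_le.1 hSE
  linarith

theorem frobNorm_conj_diagonal {d : ℕ} {P : Matrix (Fin d) (Fin d) ℝ} (hP : Pᵀ * P = 1)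
    (z : Fin d → ℝ) : frobNorm (P * diagonal z * Pᵀ) = √(∑ i, z i ^ 2) := by
  refine (Real.sqrt_eq_iff_eq_sq (by positivity) (frobNorm_nonneg _)).2 ?_ |>.symm
  have : (P * diagonal z * Pᵀ)ᵀ * (P * diagonal z * Pᵀ)
      = P * (diagonal z * ((Pᵀ * P) * (diagonal z * Pᵀ))) := by
    simp only [Matrix.transpose_mul, Matrix.transpose_transpose, Matrix.diagonal_transpose,
      Matrix.mul_assoc]
  rw [frobNorm_sq, this, hP, Matrix.one_mul, Matrix.trace_mul_comm, Matrix.mul_assoc,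
    Matrix.mul_assoc, hP, Matrix.mul_one, Matrix.diagonal_mul_diagonal, Matrix.trace_diagonal]
  simp [sq]

theorem empCov_posSemidef {d n : ℕ} (X : Matrix (Fin d) (Fin n) ℝ) : (empCov X).PosSemidef := by
  have := Matrix.posSemidef_self_mul_conjTranspose X
  rw [Matrix.conjTranspose_eq_transpose_of_trivial] at this
  exact this.smul (by positivity)

theorem sortedEigenvalues_empCov_nonneg {d n : ℕ} (X : Matrix (Fin d) (Fin n) ℝ) (i : Fin d) :
    0 ≤ sortedEigenvalues (empCov_isHermitian X) i := by
  have h := (empCov_posSemidef X).eigenvalues_nonneg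
    (Fintype.equivOfCardEq (Fintype.card_fin _) (Fin.cast (Fintype.card_fin d).symm i))
  simpa [Matrix.IsHermitian.eigenvalues, sortedEigenvalues] using h

/-- The error of the algorithm on the event that the form of the matrix noise is at most `r` and the
norm of the vector noise is at most `e`. -/
theorem IsSeparateCovOutput.frobNorm_sub_le {d n : ℕ} {X : Matrix (Fin d) (Fin n) ℝ}
    {ρ : ℝ} {y : Fin d → ℝ} {g : UpperIdx d → ℝ} {S : Matrix (Fin d) (Fin d) ℝ}
    (hS : IsSeparateCovOutput X ρ y g S) {r e : ℝ}
    (hg : ∀ v : Fin d → ℝ, |∑ i, ∑ j, symMatrix g i j * (v i * v j)| ≤ r * ∑ i, v i ^ 2)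
    (hy : √(∑ i, y i ^ 2) ≤ e) :
    frobNorm (S - empCov X) ≤ √(4 * (1 / (√(ρ / 2) * n) * r) * (empCov X).trace)
      + √2 / (√ρ * n) * e := by
  obtain ⟨P, ⟨hPo, hPM⟩, rfl⟩ := hS
  obtain ⟨Q, hQo, hQM⟩ := exists_isEigenvectorMatrix (empCov_isHermitian X)
  have hP : Pᵀ * P = 1 := (Matrix.mem_orthogonalGroup_iff' _ _).1 hPo
  have hQ : Qᵀ * Q = 1 := (Matrix.mem_orthogonalGroup_iff' _ _).1 hQo
  set a := sortedEigenvalues (empCov_isHermitian X) with ha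
  set c := √2 / (√ρ * n)
  have hc : 0 ≤ c := by positivity
  have htr : (empCov X).trace = ∑ i, a i := by
    rw [hQM, Matrix.trace_mul_comm, ← Matrix.mul_assoc, hQ, Matrix.one_mul, Matrix.trace_diagonal]
  have h1 := frobNorm_conj_diagonal_sub_sq_le hP hQ
    (sortedEigenvalues_antitone (empCov_isHermitian X))
    (sortedEigenvalues_antitone (gaussCov_isHermitian X (ρ / 2) g))
    (sortedEigenvalues_empCov_nonneg X) (E := (1 / (√(ρ / 2) * n)) • symMatrix g)
    (κ := 1 / (√(ρ / 2) * n) * r) (by rw [← hQM, ← hPM]; rfl) (by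
      intro v
      have hk : 0 ≤ 1 / (√(ρ / 2) * n) := by positivity
      simp only [Matrix.smul_apply, smul_eq_mul, mul_assoc, ← Finset.mul_sum]
      rw [abs_mul, abs_of_nonneg hk]
      exact mul_le_mul_of_nonneg_left (hg v) hk)
  rw [← htr, ← hQM] at h1
  have hsplit : P * diagonal (fun i => a i + c * y i) * Pᵀ - empCov X
      = (P * diagonal a * Pᵀ - empCov X) + P * diagonal (fun i => c * y i) * Pᵀ := by
    rw [← Matrix.diagonal_add, Matrix.mul_add, Matrix.add_mul]
    abel
  rw [hsplit]
  refine (frobNorm_add_le _ _).trans (add_le_add (Real.le_sqrt_of_sq_le h1) ?_)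
  rw [frobNorm_conj_diagonal hP]
  simp_rw [mul_pow, ← Finset.mul_sum]
  rw [Real.sqrt_mul (sq_nonneg c), Real.sqrt_sq hc]
  exact mul_le_mul_of_nonneg_left hy hc

/-! ### The error bound and its order -/

theorem one_le_plog (x : ℝ) : 1 ≤ plog x := by
  unfold plog
  split_ifs with h
  · exact le_rfl
  · push Not at h
    rw [Real.le_log_iff_exp_le ((Real.exp_pos 1).trans h)]
    exact h.le

theorem log_le_plog {x : ℝ} (hx : 0 < x) : Real.log x ≤ plog x := by
  unfold plog
  split_ifs with h
  · rwa [Real.log_le_iff_le_exp hx]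
  · exact le_rfl

theorem plog_two_mul_le {x : ℝ} (hx : 0 < x) : plog (2 * x) ≤ 2 * plog x := by
  have h1 := one_le_plog x
  have h2 := log_le_plog hx
  have h3 := Real.log_two_lt_d9
  conv_lhs => unfold plog
  split_ifs with h
  · linarith
  · rw [Real.log_mul (by norm_num) hx.ne']
    linarith

theorem plog_one_div_half_le {β : ℝ} (hβ : 0 < β) : plog (1 / (β / 2)) ≤ 2 * plog (1 / β) := by
  have : 1 / (β / 2) = 2 * (1 / β) := by field_simp
  rw [this]
  exact plog_two_mul_le (by positivity)

theorem exp_neg_plog_le {β : ℝ} (hβ : 0 < β) : Real.exp (-plog (1 / β)) ≤ β := by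
  have h := log_le_plog (one_div_pos.2 hβ)
  rw [one_div, Real.log_inv] at h
  rw [← Real.le_log_iff_exp_le hβ, one_div]
  linarith

theorem plog_natCast_le {d : ℕ} (hd : 0 < d) : plog d ≤ d := by
  have hd1 : (1 : ℝ) ≤ d := by exact_mod_cast hd
  unfold plog
  split_ifs with h
  · exact hd1
  · have := Real.log_le_sub_one_of_pos (by linarith : (0 : ℝ) < d)
    linarith

/-- The last denominator in `upsilon` equals `1`. -/
theorem plog_one_add_rpow {d : ℕ} (hd : 0 < d) :
    plog (1 + (plog d / d) ^ (1 / 3 : ℝ)) = 1 ∧ 0 ≤ (plog d / d) ^ (1 / 3 : ℝ)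
      ∧ (plog d / d) ^ (1 / 3 : ℝ) ≤ 1 := by
  have hd0 : (0 : ℝ) < d := by exact_mod_cast hd
  have h0 : 0 ≤ plog d / d := div_nonneg (zero_le_one.trans (one_le_plog _)) hd0.le
  have h1 : (plog d / d) ^ (1 / 3 : ℝ) ≤ 1 :=
    Real.rpow_le_one h0 ((div_le_one hd0).2 (plog_natCast_le hd)) (by norm_num)
  refine ⟨if_pos ?_, Real.rpow_nonneg h0 _, h1⟩
  have := Real.exp_one_gt_d9
  linarith

theorem le_upsilon {d : ℕ} (hd : 0 < d) (β : ℝ) :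
    2 * √(d : ℝ) + (6 * √(plog d) + 2 * √(2 * plog (1 / β))) ≤ upsilon d β := by
  obtain ⟨h1, h2, h3⟩ := plog_one_add_rpow hd
  unfold upsilon
  rw [h1, Real.sqrt_one, div_one]
  have h4 : 0 ≤ 2 * (d : ℝ) ^ (1 / 6 : ℝ) * plog d ^ (1 / 3 : ℝ) := by
    have := one_le_plog d
    positivity
  have h5 := mul_nonneg h2 (Real.sqrt_nonneg (plog d))
  linarith

theorem upsilon_nonneg {d : ℕ} (hd : 0 < d) (β : ℝ) : 0 ≤ upsilon d β :=
  le_trans (by positivity) (le_upsilon hd β)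

/-- The norm of the matrix noise is at most `υ(d, β)` with probability `1 - β`. -/
theorem gaussPi_upsilon_tail {d : ℕ} (hd : 0 < d) {β : ℝ} (hβ : 0 < β) :
    gaussPi _ {g : UpperIdx d → ℝ | ∃ y : Fin d → ℝ, upsilon d β * ∑ i, y i ^ 2 <
        |∑ i, ∑ j, symMatrix g i j * (y i * y j)|} ≤ ENNReal.ofReal β := by
  have hd1 : (1 : ℝ) ≤ d := by exact_mod_cast hd
  set p := plog d with hp
  set u := plog (1 / β) with hu
  have hp1 : 1 ≤ p := one_le_plog _
  have hu1 : 1 ≤ u := one_le_plog _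
  set s := 6 * √p + 2 * √(2 * u) with hs
  have hs0 : 0 < s := by positivity
  refine le_trans (measure_mono ?_) ((gaussPi_wigner_opNorm hd hs0).trans
    (ENNReal.ofReal_le_ofReal ?_))
  · rintro g ⟨y, hy⟩
    exact ⟨y, (mul_le_mul_of_nonneg_right (le_upsilon hd β) (by positivity)).trans_lt hy⟩
  · -- The two squares in `s ^ 2` beat the confidence `u` and the union bound over the dimension.
    have hs2 : u + 4 * p ≤ s ^ 2 / 8 := by
      have h1 : √p ^ 2 = p := Real.sq_sqrt (by linarith)
      have h2 : √(2 * u) ^ 2 = 2 * u := Real.sq_sqrt (by linarith)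
      have h3 : 0 ≤ √p * √(2 * u) := by positivity
      rw [hs]
      nlinarith
    have hdp : (d : ℝ) ≤ Real.exp p := by
      rw [← Real.log_le_iff_le_exp (by linarith)]
      exact log_le_plog (by linarith)
    have h8 : 8 ≤ Real.exp (3 * p) := by
      have h2 : 2 ≤ Real.exp p := by linarith [Real.add_one_le_exp p]
      calc (8 : ℝ) = 2 ^ 3 := by norm_num
        _ ≤ Real.exp p ^ 3 := by gcongr
        _ = _ := by rw [← Real.exp_nat_mul]; norm_num
    calc 4 * ((d : ℝ) + 1) * Real.exp (-s ^ 2 / 8)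
        ≤ 8 * d * Real.exp (-u + -(3 * p) + -p) :=
          mul_le_mul (by linarith) (Real.exp_le_exp.2 (by linarith)) (Real.exp_pos _).le
            (by positivity)
      _ ≤ Real.exp (3 * p) * Real.exp p * Real.exp (-u + -(3 * p) + -p) := by gcongr
      _ = Real.exp (-u) := by
          rw [← Real.exp_add, ← Real.exp_add]
          congr 1
          ring
      _ ≤ β := exp_neg_plog_le hβ

/-- The norm of the vector noise is at most `η(d, β)` with probability `1 - β`. -/
theorem gaussPi_eta_tail {d : ℕ} (hd : 0 < d) {β : ℝ} (hβ : 0 < β) :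
    gaussPi _ {y : Fin d → ℝ | eta d β < √(∑ i, y i ^ 2)} ≤ ENNReal.ofReal β := by
  have : Nonempty (Fin d) := ⟨⟨0, hd⟩⟩
  have hu := zero_lt_one.trans_le (one_le_plog (1 / β))
  have h := gaussPi_sq_norm_tail (ι := Fin d) hu
  rw [Fintype.card_fin] at h
  refine le_trans (measure_mono ?_) (h.trans (ENNReal.ofReal_le_ofReal (exp_neg_plog_le hβ)))
  intro y hy
  exact lt_of_not_ge fun hle => not_le_of_gt hy (Real.sqrt_le_sqrt hle)

theorem sqrt_opNorm_term_eq {ρ t u : ℝ} {n : ℕ} (hρ : 0 < ρ) (ht : 0 ≤ t) (hu : 0 ≤ u)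
    (hn : 0 < n) : √(4 * (1 / (√(ρ / 2) * n) * u) * t)
      = (2 : ℝ) ^ (5 / 4 : ℝ) * √t / (ρ ^ (1 / 4 : ℝ) * √(n : ℝ)) * √u := by
  have hn0 : (0 : ℝ) < n := by exact_mod_cast hn
  rw [Real.sqrt_eq_iff_eq_sq (by positivity) (by positivity)]
  have h1 : ((2 : ℝ) ^ (5 / 4 : ℝ)) ^ 2 = 4 * √2 := by
    rw [← Real.rpow_natCast, ← Real.rpow_mul (by norm_num), Real.sqrt_eq_rpow,
      show (4 : ℝ) = 2 ^ (2 : ℝ) by norm_num, ← Real.rpow_add (by norm_num)]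
    norm_num
  have h2 : (ρ ^ (1 / 4 : ℝ)) ^ 2 = √ρ := by
    rw [← Real.rpow_natCast, ← Real.rpow_mul hρ.le, Real.sqrt_eq_rpow]
    norm_num
  rw [mul_pow, div_pow, mul_pow, mul_pow, h1, h2, Real.sq_sqrt ht, Real.sq_sqrt hu,
    Real.sq_sqrt hn0.le, Real.sqrt_div hρ.le]
  have := Real.sqrt_pos.2 hρ
  field_simp

/-- The two noises are independent of each other, but a union bound, with half of the failure
probability for each of them, is enough. -/
theorem noiseLaw_error_le {d n : ℕ} (hd : 0 < d) (hn : 0 < n) {ρ : ℝ} (hρ : 0 < ρ)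
    (X : Matrix (Fin d) (Fin n) ℝ) {β : ℝ} (hβ : 0 < β) :
    noiseLaw d {ω | ∃ S, IsSeparateCovOutput X ρ ω.1 ω.2 S ∧
        errBound d n ρ β (empCov X).trace < frobNorm (S - empCov X)} ≤ ENNReal.ofReal β := by
  set E₁ := {y : Fin d → ℝ | eta d (β / 2) < √(∑ i, y i ^ 2)} with hE₁
  set E₂ := {g : UpperIdx d → ℝ | ∃ y : Fin d → ℝ, upsilon d (β / 2) * ∑ i, y i ^ 2 <
        |∑ i, ∑ j, symMatrix g i j * (y i * y j)|} with hE₂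
  have hsub : {ω : (Fin d → ℝ) × (UpperIdx d → ℝ) | ∃ S, IsSeparateCovOutput X ρ ω.1 ω.2 S ∧
        errBound d n ρ β (empCov X).trace < frobNorm (S - empCov X)}
      ⊆ (E₁ ×ˢ Set.univ) ∪ (Set.univ ×ˢ E₂) := by
    rintro ⟨y, g⟩ ⟨S, hS, herr⟩
    by_contra hcon
    simp only [Set.mem_union, Set.mem_prod, Set.mem_univ, and_true, true_and, not_or, hE₁, hE₂,
      Set.mem_ofPred_eq, not_exists, not_lt] at hcon
    have h := hS.frobNorm_sub_le hcon.2 hcon.1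
    rw [sqrt_opNorm_term_eq hρ (empCov_posSemidef X).trace_nonneg (upsilon_nonneg hd _) hn] at h
    exact not_le_of_gt herr h
  have hlaw : noiseLaw d = (gaussPi (Fin d)).prod (gaussPi (UpperIdx d)) := rfl
  rw [hlaw]
  calc _ ≤ (gaussPi (Fin d)).prod (gaussPi (UpperIdx d)) ((E₁ ×ˢ Set.univ) ∪ (Set.univ ×ˢ E₂)) :=
        measure_mono hsub
    _ ≤ gaussPi _ E₁ + gaussPi _ E₂ := by
        refine (measure_union_le _ _).trans ?_
        simp [Measure.prod_prod]
    _ ≤ ENNReal.ofReal (β / 2) + ENNReal.ofReal (β / 2) :=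
        add_le_add (gaussPi_eta_tail hd (half_pos hβ)) (gaussPi_upsilon_tail hd (half_pos hβ))
    _ = ENNReal.ofReal β := by
        rw [← ENNReal.ofReal_add (by positivity) (by positivity), add_halves]

theorem upsilon_half_le {d : ℕ} (hd : 0 < d) {β : ℝ} (hβ : 0 < β) :
    upsilon d (β / 2) ≤ 25 * (√(d : ℝ) * (plog d * plog (1 / β)) ^ 2) := by
  have hd1 : (1 : ℝ) ≤ d := by exact_mod_cast hd
  obtain ⟨h1, h2, h3⟩ := plog_one_add_rpow hd
  have hu := plog_one_div_half_le hβ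
  unfold upsilon
  rw [h1, Real.sqrt_one, div_one]
  set p := plog d
  set u := plog (1 / β)
  have hp1 : 1 ≤ p := one_le_plog _
  have hu1 : 1 ≤ u := one_le_plog _
  have hs1 : 1 ≤ √(d : ℝ) := Real.one_le_sqrt.2 hd1
  have ha : (d : ℝ) ^ (1 / 6 : ℝ) ≤ √d := by
    rw [Real.sqrt_eq_rpow]
    exact Real.rpow_le_rpow_of_exponent_le hd1 (by norm_num)
  have hb : p ^ (1 / 3 : ℝ) ≤ p := by
    calc p ^ (1 / 3 : ℝ) ≤ p ^ (1 : ℝ) := Real.rpow_le_rpow_of_exponent_le hp1 (by norm_num)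
      _ = p := Real.rpow_one p
  have hc : √p ≤ p := Real.sqrt_le_iff.2 ⟨by linarith, by nlinarith⟩
  have he : √(2 * plog (1 / (β / 2))) ≤ 2 * u := by
    rw [Real.sqrt_le_left (by positivity)]
    nlinarith
  have hpu : p ≤ (p * u) ^ 2 := by nlinarith [mul_le_mul hp1 hu1 zero_le_one (by linarith)]
  have hup : u ≤ (p * u) ^ 2 := by nlinarith [mul_le_mul hp1 hu1 zero_le_one (by linarith)]
  set w := (p * u) ^ 2
  have hw : 1 ≤ w := hp1.trans hpu
  have t1 : (d : ℝ) ^ (1 / 6 : ℝ) * p ^ (1 / 3 : ℝ) ≤ √d * w :=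
    mul_le_mul ha (hb.trans hpu) (by positivity) (by positivity)
  have t2 : √(d : ℝ) * 1 ≤ √d * w := by gcongr
  have t3 : 1 * p ≤ √d * w := mul_le_mul hs1 hpu (by linarith) (by linarith)
  have t4 : 1 * u ≤ √d * w := mul_le_mul hs1 hup (by linarith) (by linarith)
  have t5 : (1 + (p / d) ^ (1 / 3 : ℝ)) * √p ≤ 2 * p :=
    mul_le_mul (by linarith) hc (Real.sqrt_nonneg _) (by norm_num)
  linarith

theorem eta_half_le {d : ℕ} (hd : 0 < d) {β : ℝ} (hβ : 0 < β) :
    eta d (β / 2) ≤ 3 * (√(d : ℝ) * (plog d * plog (1 / β))) := by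
  have hd1 : (1 : ℝ) ≤ d := by exact_mod_cast hd
  have hu := plog_one_div_half_le hβ
  have hp1 : 1 ≤ plog d := one_le_plog _
  have hu1 : 1 ≤ plog (1 / β) := one_le_plog _
  have hv1 : 1 ≤ plog (1 / (β / 2)) := one_le_plog _
  unfold eta
  set p := plog d
  set u := plog (1 / β)
  set v := plog (1 / (β / 2))
  have h1 : √(d * v) ≤ 3 / 2 * (d * u) := by
    rw [Real.sqrt_le_left (by positivity)]
    nlinarith [mul_le_mul hd1 hu1 zero_le_one (by linarith), mul_pos (by linarith : (0:ℝ) < d)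
      (by linarith : 0 < u), mul_le_mul_of_nonneg_left hu (by linarith : (0:ℝ) ≤ d)]
  have h2 : (d : ℝ) * 1 ≤ d * u := by gcongr
  have h3 : 1 * u ≤ d * u := by gcongr
  have h4 : 1 * u ≤ p * u := by gcongr
  have h5 : u ≤ (p * u) ^ 2 := by nlinarith
  rw [Real.sqrt_le_left (by positivity), mul_pow, mul_pow, Real.sq_sqrt (by linarith)]
  have h6 : (d : ℝ) * u ≤ d * (p * u) ^ 2 := by gcongr
  nlinarith

theorem sqrt_sqrt_natCast (d : ℕ) : √(√(d : ℝ)) = (d : ℝ) ^ (1 / 4 : ℝ) := by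
  rw [Real.sqrt_eq_rpow, Real.sqrt_eq_rpow, ← Real.rpow_mul (by positivity)]
  norm_num

/-- The order of the error bound, up to logarithms. -/
theorem errBound_le {d n : ℕ} (hd : 0 < d) (hn : 0 < n) {ρ : ℝ} (hρ : 0 < ρ) {β : ℝ} (hβ : 0 < β)
    (t : ℝ) :
    errBound d n ρ β t ≤ 20 * (plog d * plog (1 / β)) *
      ((d : ℝ) ^ (1 / 4 : ℝ) * √t / (ρ ^ (1 / 4 : ℝ) * √(n : ℝ)) + √(d : ℝ) / (√ρ * n)) := by
  have hn0 : (0 : ℝ) < n := by exact_mod_cast hn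
  have hp1 : 1 ≤ plog d := one_le_plog _
  have hu1 : 1 ≤ plog (1 / β) := one_le_plog _
  have hη := eta_half_le hd hβ
  have hη0 : 0 ≤ eta d (β / 2) := Real.sqrt_nonneg _
  have hυ : √(upsilon d (β / 2)) ≤ 5 * ((d : ℝ) ^ (1 / 4 : ℝ) * (plog d * plog (1 / β))) := by
    refine (Real.sqrt_le_sqrt (upsilon_half_le hd hβ)).trans (le_of_eq ?_)
    rw [Real.sqrt_mul (by norm_num), Real.sqrt_mul (by positivity), Real.sqrt_sq (by positivity),
      sqrt_sqrt_natCast, show (25 : ℝ) = 5 ^ 2 by norm_num, Real.sqrt_sq (by norm_num)]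
  have h2 : (2 : ℝ) ^ (5 / 4 : ℝ) ≤ 4 := by
    calc (2 : ℝ) ^ (5 / 4 : ℝ) ≤ 2 ^ (2 : ℝ) :=
          Real.rpow_le_rpow_of_exponent_le (by norm_num) (by norm_num)
      _ = 4 := by norm_num
  have h3 : √2 ≤ 2 := Real.sqrt_le_iff.2 ⟨by norm_num, by norm_num⟩
  have hsρ : 0 < √ρ := Real.sqrt_pos.2 hρ
  unfold errBound
  set w := plog d * plog (1 / β)
  have hw : 0 ≤ w := by positivity
  calc _ ≤ 4 * √t / (ρ ^ (1 / 4 : ℝ) * √(n : ℝ)) * (5 * ((d : ℝ) ^ (1 / 4 : ℝ) * w))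
        + 2 / (√ρ * n) * (3 * (√(d : ℝ) * w)) := by
        gcongr
    _ = 20 * w * ((d : ℝ) ^ (1 / 4 : ℝ) * √t / (ρ ^ (1 / 4 : ℝ) * √(n : ℝ)))
        + 6 * w * (√(d : ℝ) / (√ρ * n)) := by ring
    _ ≤ 20 * w * ((d : ℝ) ^ (1 / 4 : ℝ) * √t / (ρ ^ (1 / 4 : ℝ) * √(n : ℝ)))
        + 20 * w * (√(d : ℝ) / (√ρ * n)) := by
        gcongr
        norm_num
    _ = _ := by ring

theorem trace_empCov_le_one {d n : ℕ} (hn : 0 < n) {X : Matrix (Fin d) (Fin n) ℝ}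
    (hX : ColsInBall X) : (empCov X).trace ≤ 1 := by
  have hn0 : (0 : ℝ) < n := by exact_mod_cast hn
  have hcol : ∀ i, ∑ j, X j i ^ 2 ≤ 1 := by
    intro i
    have h := hX i
    rw [EuclideanSpace.norm_eq, Real.sqrt_le_one] at h
    simpa using h
  have : (empCov X).trace = 1 / (n : ℝ) * ∑ i, ∑ j, X j i ^ 2 := by
    rw [empCov, Matrix.trace_smul, smul_eq_mul, Matrix.trace_mul_comm]
    simp [Matrix.trace, Matrix.mul_apply, sq]
  rw [this, one_div, inv_mul_le_iff₀ hn0]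
  calc ∑ i, ∑ j, X j i ^ 2 ≤ ∑ _i : Fin n, (1 : ℝ) := Finset.sum_le_sum fun i _ => hcol i
    _ = n * 1 := by simp

theorem errBound_mono {d n : ℕ} {ρ β s t : ℝ} (hρ : 0 < ρ) (hst : s ≤ t) :
    errBound d n ρ β s ≤ errBound d n ρ β t := by
  unfold errBound
  gcongr

/-- In the regime `d ≤ K log(n)^m n²`, the second term of the error bound is at most of the order of
the first one. -/
theorem sqrt_div_le_of_le_sq {d n : ℕ} (hn : 0 < n) {K : ℝ} (hK : 0 < K) {m : ℕ}
    (hdn : (d : ℝ) ≤ K * plog n ^ m * (n : ℝ) ^ 2) :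
    √(d : ℝ) / n ≤ (1 + K) * plog n ^ m * ((d : ℝ) ^ (1 / 4 : ℝ) / √(n : ℝ)) := by
  have hn0 : (0 : ℝ) < n := by exact_mod_cast hn
  have hl : 1 ≤ plog n ^ m := one_le_pow₀ (one_le_plog _)
  set l := plog n ^ m
  have hKl : 1 ≤ (1 + K) * l := by nlinarith
  have h1 : (d : ℝ) ^ (1 / 4 : ℝ) ≤ (1 + K) * l * √(n : ℝ) := by
    rw [← sqrt_sqrt_natCast]
    rw [Real.sqrt_le_left (by positivity), Real.sqrt_le_left (by positivity), mul_pow, mul_pow,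
      Real.sq_sqrt hn0.le, mul_pow]
    refine hdn.trans ?_
    gcongr
    rw [← mul_pow]
    calc K * l ≤ (1 + K) * l := by gcongr; linarith
      _ ≤ (((1 + K) * l) ^ 2) := by nlinarith
      _ ≤ (((1 + K) * l) ^ 2) ^ 2 := by nlinarith [one_le_pow₀ hKl (n := 2)]
  have hs : √(n : ℝ) ^ 2 = n := Real.sq_sqrt hn0.le
  have hs0 : 0 < √(n : ℝ) := Real.sqrt_pos.2 hn0
  have hd4 : √(d : ℝ) = (d : ℝ) ^ (1 / 4 : ℝ) * (d : ℝ) ^ (1 / 4 : ℝ) := by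
    rw [← sqrt_sqrt_natCast, Real.mul_self_sqrt (Real.sqrt_nonneg _)]
  calc √(d : ℝ) / n = (d : ℝ) ^ (1 / 4 : ℝ) / √(n : ℝ) * ((d : ℝ) ^ (1 / 4 : ℝ) / √(n : ℝ)) := by
        rw [hd4]
        nth_rewrite 1 [← hs]
        field_simp
    _ ≤ (1 + K) * l * ((d : ℝ) ^ (1 / 4 : ℝ) / √(n : ℝ)) := by
        gcongr
        rwa [div_le_iff₀ hs0]

theorem errBound_one_le {d n : ℕ} (hd : 0 < d) (hn : 0 < n) {K : ℝ} (hK : 0 < K) {m : ℕ}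
    (hdn : (d : ℝ) ≤ K * plog n ^ m * (n : ℝ) ^ 2) {ρ : ℝ} (hρ : 0 < ρ) {β : ℝ} (hβ : 0 < β) :
    errBound d n ρ β 1 ≤ 20 * (1 + K) * (1 / ρ ^ (1 / 4 : ℝ) + 1 / √ρ) *
      (plog d * plog n * plog (1 / β)) ^ (m + 1) * ((d : ℝ) ^ (1 / 4 : ℝ) / √(n : ℝ)) := by
  have hn0 : (0 : ℝ) < n := by exact_mod_cast hn
  have hp1 : 1 ≤ plog d := one_le_plog _
  have hl1 : 1 ≤ plog n := one_le_plog _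
  have hu1 : 1 ≤ plog (1 / β) := one_le_plog _
  have hlm : 1 ≤ plog n ^ m := one_le_pow₀ hl1
  have h1 := errBound_le hd hn hρ hβ 1
  have h2 := sqrt_div_le_of_le_sq hn hK hdn
  have hsρ : 0 < √ρ := Real.sqrt_pos.2 hρ
  rw [Real.sqrt_one, mul_one] at h1
  set p := plog d
  set l := plog n
  set u := plog (1 / β)
  set q := (d : ℝ) ^ (1 / 4 : ℝ) / √(n : ℝ) with hq
  have hq0 : 0 ≤ q := by positivity
  have hpow : p * u * l ^ m ≤ (p * l * u) ^ (m + 1) := by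
    have hpu : 1 ≤ p * u := one_le_mul_of_one_le_of_one_le hp1 hu1
    calc p * u * l ^ m ≤ (p * u) ^ (m + 1) * l ^ (m + 1) := by
          gcongr
          · exact le_self_pow₀ hpu (by omega)
          · omega
      _ = _ := by rw [← mul_pow]; ring
  calc errBound d n ρ β 1 ≤ 20 * (p * u) * (q * (1 / ρ ^ (1 / 4 : ℝ)) + √d / n * (1 / √ρ)) := by
        refine h1.trans (le_of_eq ?_)
        rw [hq]
        field_simp
    _ ≤ 20 * (p * u) * ((1 + K) * l ^ m * q * (1 / ρ ^ (1 / 4 : ℝ))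
        + (1 + K) * l ^ m * q * (1 / √ρ)) := by
        gcongr
        exact le_mul_of_one_le_left hq0 (by nlinarith)
    _ = 20 * (1 + K) * (1 / ρ ^ (1 / 4 : ℝ) + 1 / √ρ) * (p * u * l ^ m) * q := by ring
    _ ≤ _ := by gcongr

end SepCov

end

open SepCov in
theorem mainTheorem1 :
    -- With probability at least `1 - β`, every output of `SeparateCov` obeys the error bound.
    (∀ (d n : ℕ), 0 < d → 0 < n → ∀ (ρ : ℝ), 0 < ρ →
      ∀ (X : Matrix (Fin d) (Fin n) ℝ), ColsInBall X → ∀ (β : ℝ), 0 < β →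
        noiseLaw d {ω | ∃ S, IsSeparateCovOutput X ρ ω.1 ω.2 S ∧
            errBound d n ρ β (empCov X).trace < frobNorm (S - empCov X)}
          ≤ ENNReal.ofReal β) ∧
    -- The trace-sensitive order of the error bound.
    (∃ C : ℝ, 0 < C ∧ ∃ k : ℕ,
      ∀ (d n : ℕ), 0 < d → 0 < n → ∀ (ρ : ℝ), 0 < ρ →
      ∀ (X : Matrix (Fin d) (Fin n) ℝ), ColsInBall X → ∀ (β : ℝ), 0 < β →
        errBound d n ρ β (empCov X).trace ≤
          C * (plog d * plog (1 / β)) ^ k *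
            ((d : ℝ) ^ (1 / 4 : ℝ) * √((empCov X).trace) / (ρ ^ (1 / 4 : ℝ) * √(n : ℝ))
              + √(d : ℝ) / (√ρ * n))) ∧
    -- The worst-case order, in the regime where `d` is at most `n ^ 2` up to polylogarithms.
    (∀ K : ℝ, 0 < K → ∀ m : ℕ, ∃ C : ℝ, 0 < C ∧ ∃ k : ℕ,
      ∀ (d n : ℕ), 0 < d → 0 < n → (d : ℝ) ≤ K * (plog n) ^ m * (n : ℝ) ^ 2 →
      ∀ (ρ : ℝ), 0 < ρ →
      ∀ (X : Matrix (Fin d) (Fin n) ℝ), ColsInBall X → ∀ (β : ℝ), 0 < β →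
        errBound d n ρ β (empCov X).trace ≤ errBound d n ρ β 1 ∧
        errBound d n ρ β 1 ≤
          C * (1 / ρ ^ (1 / 4 : ℝ) + 1 / √ρ) * (plog d * plog n * plog (1 / β)) ^ k *
            ((d : ℝ) ^ (1 / 4 : ℝ) / √(n : ℝ))) := by
  refine ⟨?_, ?_, ?_⟩
  · intro d n hd hn ρ hρ X _ β hβ
    exact noiseLaw_error_le hd hn hρ X hβ
  · refine ⟨20, by norm_num, 1, ?_⟩
    intro d n hd hn ρ hρ X _ β hβ
    rw [pow_one]
    exact errBound_le hd hn hρ hβ _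
  · intro K hK m
    refine ⟨20 * (1 + K), by positivity, m + 1, ?_⟩
    intro d n hd hn hdn ρ hρ X hX β hβ
    exact ⟨errBound_mono hρ (trace_empCov_le_one hn hX), errBound_one_le hd hn hK hdn hρ hβ⟩
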